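/- Let $N\ge 1$, $S>0$, $K(y)=e^{|y|^2/4}$ on $\mathbb R^N$, and let $L^2(K)$ be the real Hilbert space with inner product $(f,g)=\int_{\mathbb R^N} f g\,K\,dy$. Let $H^1(K)=\{f\in L^2(K):\ \partial f/\partial y_i\in L^2(K),\ 1\le i\le N\}$ (weak derivatives) with norm $\big(\int(|f|^2+|\nabla f|^2)K\,dy\big)^{1/2}$, let $H^{-1}(K)$ be its topological dual with duality pairing $\langle\cdot,\cdot\rangle$, and embed $L^2(K)\subset H^{-1}(K)$ by $\langle f,z\rangle=(f,z)$. Put $Lv=-\Delta v-\tfrac12 y\cdot\nabla v=-\tfrac1K\operatorname{div}(K\nabla v)$. Let $A\in L^\infty(\mathbb R^N\times(0,S))$, $B\in (L^\infty(\mathbb R^N\times(0,S)))^N$ and $\xi\in H^{-1}(K)$. For $\varphi\in L^2(0,S;L^2(K))$, a solution of the state problem $$v_s+Lv+Av+B\cdot\nabla v-\tfrac N2 v=\varphi\ \text{ in }\mathbb R^N\times(0,S),\qquad v(0)=0,$$ is a function $v\in L^2(0,S;H^1(K))\cap C([0,S];L^2(K))$ with distributional derivative $v_s\in L^2(0,S;H^{-1}(K))$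 such that $v(0)=0$ and, for a.e. $s\in(0,S)$ and all $z\in H^1(K)$, $$\langle v_s,z\rangle+\int_{\mathbb R^N}\Big(\nabla v\cdot\nabla z+A v z+(B\cdot\nabla v)z-\tfrac N2 vz\Big)K\,dy=(\varphi,z).$$ A function $p\in L^2(0,S;L^2(K))$ is called a solution by transposition of $$-p_s+Lp+Ap-\operatorname{div}(Bp)-\tfrac N2p-\tfrac12\,y\cdot Bp=0\ \text{ in }\mathbb R^N\times(0,S),\qquad p(S)=\xi,$$ if, for every $\varphi\in L^2(0,S;L^2(K))$ and every solution $v$ of the state problem with right-hand side $\varphi$, one has $v(S)\in H^1(K)$ and $$\int_0^S\int_{\mathbb R^N}p\,\varphi\,K\,dy\,ds=\langle\xi,v(S)\rangle .$$ Theorem. There is a unique $p\in L^2(0,S;L^2(K))$ that is a solution by transposition of this backward problem. Moreover $p\in C([0,S];H^{-1}(K))$, that is, $p$ agrees a.e. on $(0,S)$ with a continuous function $[0,S]\to H^{-1}(K)$, and the value of this function at $S$ is $\xi$. -/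

import Mathlib

open MeasureTheory Set
open scoped ContDiff

noncomputable section

/-- The Gaussian weight `K(y) = exp (|y|² / 4)` on `ℝᴺ`. -/
def gaussWeight (N : ℕ) (y : EuclideanSpace ℝ (Fin N)) : ℝ :=
  Real.exp (‖y‖ ^ 2 / 4)

/-- The measure `K(y) dy` on `ℝᴺ`. -/
def weightMeasure (N : ℕ) : Measure (EuclideanSpace ℝ (Fin N)) :=
  volume.withDensity (fun y => ENNReal.ofReal (gaussWeight N y))

/-- `L²(K)`, with the inner product `(f, g) = ∫ f g K dy`. -/
abbrev L2K (N : ℕ) : Type := Lp ℝ 2 (weightMeasure N)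

lemma volume_le_weightMeasure (N : ℕ) :
    (volume : Measure (EuclideanSpace ℝ (Fin N))) ≤ weightMeasure N := by
  have h : (volume : Measure (EuclideanSpace ℝ (Fin N))) = volume.withDensity 1 :=
    withDensity_one.symm
  rw [weightMeasure]
  conv_lhs => rw [h]
  refine withDensity_mono (Filter.Eventually.of_forall fun y => ?_)
  simp only [Pi.one_apply, ENNReal.one_le_ofReal, gaussWeight]
  exact Real.one_le_exp (by positivity)

/-- An element of `L²(K)` times a continuous compactly supported function is integrable for the
Lebesgue measure. -/
lemma integrable_L2K_mul {N : ℕ} (f : L2K N) {η : EuclideanSpace ℝ (Fin N) → ℝ}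
    (hη : Continuous η) (hc : HasCompactSupport η) :
    Integrable (fun y => f y * η y) volume := by
  have h1 : MemLp f 2 (volume : Measure (EuclideanSpace ℝ (Fin N))) :=
    (Lp.memLp f).mono_measure (volume_le_weightMeasure N)
  have h2 : MemLp η 2 (volume : Measure (EuclideanSpace ℝ (Fin N))) :=
    hη.memLp_of_hasCompactSupport hc
  exact h1.integrable_mul h2

/-- `g` is the weak partial derivative `∂f/∂yᵢ` on `ℝᴺ` (tested against `C_c^∞`, with respect to
the Lebesgue measure). -/
def IsWeakPartial {N : ℕ} (i : Fin N) (f g : L2K N) : Prop :=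
  ∀ η : EuclideanSpace ℝ (Fin N) → ℝ, ContDiff ℝ ∞ η → HasCompactSupport η →
    ∫ y, f y * fderiv ℝ η y (EuclideanSpace.single i 1) = -∫ y, g y * η y

lemma continuous_partial {N : ℕ} {η : EuclideanSpace ℝ (Fin N) → ℝ} (hη : ContDiff ℝ ∞ η)
    (e : EuclideanSpace ℝ (Fin N)) : Continuous (fun y => fderiv ℝ η y e) :=
  (hη.continuous_fderiv (by simp)).clm_apply continuous_const

lemma hasCompactSupport_partial {N : ℕ} {η : EuclideanSpace ℝ (Fin N) → ℝ}
    (hc : HasCompactSupport η) (e : EuclideanSpace ℝ (Fin N)) :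
    HasCompactSupport (fun y => fderiv ℝ η y e) :=
  hc.fderiv_apply (𝕜 := ℝ) e

lemma ae_volume_of_weight {N : ℕ} {P : EuclideanSpace ℝ (Fin N) → Prop}
    (h : ∀ᵐ y ∂(weightMeasure N), P y) : ∀ᵐ y, P y :=
  (volume_le_weightMeasure N).absolutelyContinuous.ae_le h

lemma integral_L2K_add {N : ℕ} (f g : L2K N) {η : EuclideanSpace ℝ (Fin N) → ℝ}
    (hη : Continuous η) (hc : HasCompactSupport η) :
    ∫ y, (f + g : L2K N) y * η y = (∫ y, f y * η y) + ∫ y, g y * η y := by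
  rw [← integral_add (integrable_L2K_mul f hη hc) (integrable_L2K_mul g hη hc)]
  refine integral_congr_ae ?_
  filter_upwards [ae_volume_of_weight (Lp.coeFn_add f g)] with y hy
  rw [hy, Pi.add_apply, add_mul]

lemma integral_L2K_smul {N : ℕ} (c : ℝ) (f : L2K N) (η : EuclideanSpace ℝ (Fin N) → ℝ) :
    ∫ y, (c • f : L2K N) y * η y = c * ∫ y, f y * η y := by
  rw [← integral_const_mul]
  refine integral_congr_ae ?_
  filter_upwards [ae_volume_of_weight (Lp.coeFn_smul c f)] with y hy
  rw [hy, Pi.smul_apply, smul_eq_mul, mul_assoc]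

/-- The graph of the weak gradient: all pairs `(f, ∇f)` with `f ∈ L²(K)` whose weak partial
derivatives all lie in `L²(K)`. -/
def H1KGraph (N : ℕ) :
    Submodule ℝ (WithLp 2 (L2K N × PiLp 2 (fun _ : Fin N => L2K N))) where
  carrier := {u | ∀ i, IsWeakPartial i u.fst (u.snd i)}
  zero_mem' := by
    intro i η hη hc
    have h := fun ζ : EuclideanSpace ℝ (Fin N) → ℝ => integral_L2K_smul 0 (0 : L2K N) ζ
    simp only [zero_smul, zero_mul] at h
    change ∫ y, (0 : L2K N) y * fderiv ℝ η y (EuclideanSpace.single i 1)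
      = -∫ y, (0 : L2K N) y * η y
    rw [h, h, neg_zero]
  add_mem' := by
    intro u v hu hv i η hη hc
    change ∫ y, (u.fst + v.fst : L2K N) y * fderiv ℝ η y (EuclideanSpace.single i 1)
      = -∫ y, (u.snd i + v.snd i : L2K N) y * η y
    rw [integral_L2K_add _ _ (continuous_partial hη _) (hasCompactSupport_partial hc _),
      integral_L2K_add _ _ hη.continuous hc, hu i η hη hc, hv i η hη hc, neg_add]
  smul_mem' := by
    intro c u hu i η hη hc
    change ∫ y, (c • u.fst : L2K N) y * fderiv ℝ η y (EuclideanSpace.single i 1)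
      = -∫ y, (c • u.snd i : L2K N) y * η y
    rw [integral_L2K_smul c u.fst (fun y => fderiv ℝ η y (EuclideanSpace.single i 1)),
      integral_L2K_smul, hu i η hη hc, mul_neg]

/-- `H¹(K)`, realized as the space of pairs `(f, ∇f)`; the (Hilbert) norm it inherits is
`(∫ (|f|² + |∇f|²) K dy)^(1/2)`. -/
abbrev H1K (N : ℕ) : Type := ↥(H1KGraph N)

/-- `H⁻¹(K)`, the topological dual of `H¹(K)`; `ξ z` is the duality pairing `⟨ξ, z⟩`. -/
abbrev HNegK (N : ℕ) : Type := H1K N →L[ℝ] ℝ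

/-- The continuous inclusion `H¹(K) ⊂ L²(K)`. -/
def H1K.toL2 {N : ℕ} : H1K N →L[ℝ] L2K N :=
  (WithLp.fstL 2 ℝ (L2K N) (PiLp 2 (fun _ : Fin N => L2K N))).comp (H1KGraph N).subtypeL

/-- The weak partial derivative `∂u/∂yᵢ ∈ L²(K)` of `u ∈ H¹(K)`. -/
def H1K.partial {N : ℕ} (u : H1K N) (i : Fin N) : L2K N := u.1.snd i

/-- The inclusion `L²(K) ⊂ H⁻¹(K)` with `L²(K)` as pivot space: `⟨f, z⟩ = ∫ f z K dy`. -/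
def L2K.toHNeg {N : ℕ} (f : L2K N) : HNegK N := (innerSL ℝ f).comp H1K.toL2

/-- Lebesgue measure on the time interval `(0, S)`. -/
abbrev timeMeasure (S : ℝ) : Measure ℝ := volume.restrict (Ioo 0 S)

/-- The Bochner space `L²(0, S; X)`. -/
abbrev L2Time (S : ℝ) (X : Type) [NormedAddCommGroup X] : Type := Lp X 2 (timeMeasure S)

/-- `w` is the distributional time derivative of `u` on `(0, S)`, both with values in `H⁻¹(K)`. -/
def IsWeakTimeDeriv {N : ℕ} (S : ℝ) (u w : ℝ → HNegK N) : Prop :=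
  ∀ θ : ℝ → ℝ, ContDiff ℝ ∞ θ → HasCompactSupport θ → tsupport θ ⊆ Ioo 0 S →
    ∫ s in Ioo 0 S, deriv θ s • u s = -∫ s in Ioo 0 S, θ s • w s

/-- The bilinear form at time `s` of `Lv + A v + B·∇v - (N/2) v`, where
`L v = -(1/K) div (K ∇v)`, that is
`∫ (∇v·∇z + A(y,s) v z + (B(y,s)·∇v) z - (N/2) v z) K(y) dy`. -/
def stateForm {N : ℕ} (A : EuclideanSpace ℝ (Fin N) × ℝ → ℝ)
    (B : EuclideanSpace ℝ (Fin N) × ℝ → EuclideanSpace ℝ (Fin N)) (s : ℝ) (v z : H1K N) : ℝ :=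
  ∫ y, ((∑ i, v.partial i y * z.partial i y)
      + A (y, s) * v.toL2 y * z.toL2 y
      + (∑ i, B (y, s) i * v.partial i y) * z.toL2 y
      - (N : ℝ) / 2 * v.toL2 y * z.toL2 y) ∂(weightMeasure N)

/-- `v ∈ W(0, S, H¹(K), H⁻¹(K))` solves
`v_s + L v + A v + B·∇v - (N/2) v = φ` in `ℝᴺ × (0, S)`, `v(0) = v₀`;
`V` is the representative of `v` in `C([0, S]; L²(K))`. -/
structure IsStateSolution {N : ℕ} (S : ℝ) (A : EuclideanSpace ℝ (Fin N) × ℝ → ℝ)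
    (B : EuclideanSpace ℝ (Fin N) × ℝ → EuclideanSpace ℝ (Fin N))
    (φ : L2Time S (L2K N)) (v₀ : L2K N) (v : L2Time S (H1K N)) (V : ℝ → L2K N) : Prop where
  continuousOn : ContinuousOn V (Icc 0 S)
  ae_eq : ∀ᵐ s ∂(timeMeasure S), V s = (v s).toL2
  initial : V 0 = v₀
  equation : ∃ w : L2Time S (HNegK N),
    IsWeakTimeDeriv S (fun s => L2K.toHNeg (v s).toL2) w ∧
    ∀ᵐ s ∂(timeMeasure S), ∀ z : H1K N,
      w s z + stateForm A B s (v s) z = inner ℝ (φ s) z.toL2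

/-- `p ∈ L²(0, S; L²(K))` is the solution by transposition of
`-p_s + L p + A p - div (B p) - (N/2) p - (1/2) y·B p = 0` in `ℝᴺ × (0, S)`, `p(S) = ξ`:
`∫_(0,S) ∫ p φ K dy ds = ⟨ξ, v(S)⟩` for every `φ ∈ L²(0, S; L²(K))` and every solution `v` of the
state equation with right-hand side `φ` and `v(0) = 0`. That `v(S)` lies in `H¹(K)`, so that the
pairing makes sense, is part of the requirement. -/
def IsTranspositionSolution {N : ℕ} (S : ℝ) (A : EuclideanSpace ℝ (Fin N) × ℝ → ℝ)
    (B : EuclideanSpace ℝ (Fin N) × ℝ → EuclideanSpace ℝ (Fin N))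
    (ξ : HNegK N) (p : L2Time S (L2K N)) : Prop :=
  ∀ (φ : L2Time S (L2K N)) (v : L2Time S (H1K N)) (V : ℝ → L2K N),
    IsStateSolution S A B φ 0 v V →
      ∃ z : H1K N, z.toL2 = V S ∧ ∫ s in Ioo 0 S, inner ℝ (p s) (φ s) = ξ z

end

/-! With the full inner product of V = H¹(K), and H = L²(K), the state form is (v, z)_V + (Cv, z)_H,
where C = A + B·∇ - (N/2 + 1) is bounded from V to H. So the problem is ∂ₜv + Λv + Cv = φ, v(0) = 0,
in a Hilbert triple V ⊂ H ⊂ V' with Λ the operator of the V-inner product. Everything is expressed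
through the inclusion j and its adjoint: j j† is Λ⁻¹ on H, and after Riesz identification of V' with
V the embedding H ⊂ V' is j†.

Maximal regularity: expanding |∂ₜv + Λv|², the cross term 2(∂ₜv, Λv) is the derivative of ‖v‖²_V.
Hence g ↦ v is bounded from L²(0,S;H) to C([0,S];V), and ‖v(t)‖²_V is at most the integral of |g|²
over (0,t) (`sq_norm_parabolicFlow_le`). No spectral theory enters: the estimate is proved for g =
Λ⁻¹h + ∫h, with h standing for ∂ₜΛv, and extended by density (`denseRange_parabolicOp`). As the
estimate sees only the past of g, the iterates of T = C(∂ₜ + Λ)⁻¹ decay factorially and 1 + T is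
invertible, whatever the size of C (`isUnit_one_add_perturbOp`).

Every weak solution is the one given by this flow: a du Bois-Reymond argument yields the integrated
equation, which an energy identity solves uniquely (`IsTripleSolution.final_eq`). So φ ↦ v(S) is a
bounded operator from L²(0,S;H) to V, and p is its adjoint applied to the Riesz representative ζ of
ξ. Since each φ does have a state (`isTripleSolution_perturbedFlow`), the transposition identity
determines p.

For continuity in V', put q = C†p. Then p is the backward solution of the unperturbed problem with
final datum ζ and source -q. The adjoint of Λ(∂ₜ + Λ)⁻¹ is its conjugate by s ↦ S - s
(`adjoint_ellipticPart`), and the adjoint of g ↦ v(S) is the reversed homogeneous flow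
(`timeMap_adjoint_evalFinal`). Therefore j†p is the time reversal of a continuous V-valued function
starting at ζ (`exists_continuous_adjoint_transpositionSolution`). -/

noncomputable section

/-! ### Primitives, truncated inner products and time reversal in L²(0, S; E) -/

section TimeIntegral

variable {E F : Type} [NormedAddCommGroup E] [InnerProductSpace ℝ E]
  [NormedAddCommGroup F] [InnerProductSpace ℝ F]

/-- Integration by parts for two primitives, in Hilbert space valued form. -/
lemma integral_inner_primitive_add [CompleteSpace E] {f g : ℝ → E} {t : ℝ}
    (hf : IntegrableOn f (Ioc 0 t)) (hg : IntegrableOn g (Ioc 0 t)) :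
    (∫ s in Ioc 0 t, inner ℝ (f s) (∫ r in Ioc 0 s, g r))
      + (∫ s in Ioc 0 t, inner ℝ (∫ r in Ioc 0 s, f r) (g s))
      = inner ℝ (∫ s in Ioc 0 t, f s) (∫ s in Ioc 0 t, g s) := by
  set ν : Measure ℝ := volume.restrict (Ioc 0 t) with hν
  have hf' : Integrable f ν := hf
  have hg' : Integrable g ν := hg
  have hF : Integrable (fun p : ℝ × ℝ => (inner ℝ (f p.1) (g p.2) : ℝ)) (ν.prod ν) := by
    refine Integrable.mono' (hf'.norm.mul_prod hg'.norm)
      (hf'.1.comp_fst.inner hg'.1.comp_snd) (Filter.Eventually.of_forall fun p => ?_)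
    exact norm_inner_le_norm _ _
  -- The square (0,t]² is cut along the diagonal; Fubini on the two triangles gives the two terms on
  -- the left, and the whole square gives the right-hand side.
  set s₁ : Set (ℝ × ℝ) := {p | p.2 ≤ p.1}
  have hs₁ : MeasurableSet s₁ := measurableSet_le measurable_snd measurable_fst
  have key := integral_add_compl hs₁ hF
  have h0 : ∫ p, (inner ℝ (f p.1) (g p.2) : ℝ) ∂(ν.prod ν)
      = inner ℝ (∫ s, f s ∂ν) (∫ s, g s ∂ν) := by
    rw [integral_prod _ hF]
    have h1 : ∀ s, ∫ r, (inner ℝ (f s) (g r) : ℝ) ∂ν = inner ℝ (f s) (∫ r, g r ∂ν) := fun s =>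
      integral_inner hg' (f s)
    simp_rw [h1]
    simp_rw [real_inner_comm (∫ r, g r ∂ν)]
    exact integral_inner hf' _
  have h1 : ∫ p in s₁, (inner ℝ (f p.1) (g p.2) : ℝ) ∂(ν.prod ν)
      = ∫ s, inner ℝ (f s) (∫ r in Ioc 0 s, g r) ∂ν := by
    rw [← integral_indicator hs₁, integral_prod _ (hF.indicator hs₁)]
    refine integral_congr_ae ?_
    filter_upwards [ae_restrict_mem measurableSet_Ioc] with s hs
    have e1 : ∀ r, s₁.indicator (fun p : ℝ × ℝ => (inner ℝ (f p.1) (g p.2) : ℝ)) (s, r)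
        = (Iic s).indicator (fun r => (inner ℝ (f s) (g r) : ℝ)) r := by
      intro r
      by_cases h : r ≤ s
      · rw [indicator_of_mem (show (s, r) ∈ s₁ from h), indicator_of_mem (show r ∈ Iic s from h)]
      · rw [indicator_of_notMem (show (s, r) ∉ s₁ from h),
          indicator_of_notMem (show r ∉ Iic s from h)]
    simp_rw [e1]
    rw [integral_indicator measurableSet_Iic, hν, Measure.restrict_restrict measurableSet_Iic]
    have e2 : Iic s ∩ Ioc 0 t = Ioc 0 s := by
      ext r; simp only [mem_inter_iff, mem_Iic, mem_Ioc]; have := hs.2; grind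
    rw [e2]
    exact integral_inner (hg.mono_set (Ioc_subset_Ioc_right hs.2)) (f s)
  have h2 : ∫ p in s₁ᶜ, (inner ℝ (f p.1) (g p.2) : ℝ) ∂(ν.prod ν)
      = ∫ s, inner ℝ (∫ r in Ioc 0 s, f r) (g s) ∂ν := by
    rw [← integral_indicator hs₁.compl, integral_prod_symm _ (hF.indicator hs₁.compl)]
    refine integral_congr_ae ?_
    filter_upwards [ae_restrict_mem measurableSet_Ioc] with s hs
    have e1 : ∀ r, s₁ᶜ.indicator (fun p : ℝ × ℝ => (inner ℝ (f p.1) (g p.2) : ℝ)) (r, s)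
        = (Iio s).indicator (fun r => (inner ℝ (f r) (g s) : ℝ)) r := by
      intro r
      by_cases h : r < s
      · rw [indicator_of_mem (show (r, s) ∈ s₁ᶜ from not_le.2 h),
          indicator_of_mem (show r ∈ Iio s from h)]
      · rw [indicator_of_notMem (show (r, s) ∉ s₁ᶜ from fun h' => h (not_le.1 h')),
          indicator_of_notMem (show r ∉ Iio s from h)]
    simp_rw [e1]
    rw [integral_indicator measurableSet_Iio, hν, Measure.restrict_restrict measurableSet_Iio]
    have e2 : Iio s ∩ Ioc 0 t = Ioo 0 s := by
      ext r; simp only [mem_inter_iff, mem_Iio, mem_Ioc, mem_Ioo]; have := hs.2; grind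
    rw [e2, ← integral_Ioc_eq_integral_Ioo]
    simp_rw [real_inner_comm (g s)]
    exact integral_inner (hf.mono_set (Ioc_subset_Ioc_right hs.2)) (g s)
  rw [h0, h1, h2] at key
  exact key

lemma timeMeasure_eq_restrict_Ioc (S : ℝ) : timeMeasure S = volume.restrict (Ioc 0 S) :=
  Measure.restrict_congr_set Ioo_ae_eq_Ioc

omit [InnerProductSpace ℝ E] in
lemma L2Time_integrable {S : ℝ} (f : L2Time S E) : Integrable f (timeMeasure S) :=
  (Lp.memLp f).integrable (by norm_num)

omit [InnerProductSpace ℝ E] in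
lemma L2Time_integrableOn_Ioc {S : ℝ} (f : L2Time S E) {t : ℝ} (ht : t ≤ S) :
    IntegrableOn f (Ioc 0 t) := by
  have : IntegrableOn f (Ioc 0 S) := by
    rw [integrableOn_Ioc_iff_integrableOn_Ioo]; exact L2Time_integrable f
  exact this.mono_set (Ioc_subset_Ioc_right ht)

lemma restrict_Ioc_le_timeMeasure {S t : ℝ} (ht : t ≤ S) :
    volume.restrict (Ioc 0 t) ≤ timeMeasure S := by
  rw [timeMeasure_eq_restrict_Ioc]
  exact Measure.restrict_mono (Ioc_subset_Ioc_right ht) le_rfl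

lemma ae_Ioc_of_ae_timeMeasure {S t : ℝ} (ht : t ≤ S) {p : ℝ → Prop}
    (h : ∀ᵐ s ∂(timeMeasure S), p s) : ∀ᵐ s ∂(volume.restrict (Ioc 0 t)), p s :=
  (restrict_Ioc_le_timeMeasure ht).absolutelyContinuous.ae_le h

omit [InnerProductSpace ℝ E] in
lemma integral_norm_L2Time_le {S : ℝ} (f : L2Time S E) :
    ∫ s, ‖f s‖ ∂(timeMeasure S) ≤ (timeMeasure S).real univ ^ (1 / 2 : ℝ) * ‖f‖ := by
  have h := eLpNorm_le_eLpNorm_mul_rpow_measure_univ (p := 1) (q := 2) (by norm_num)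
    (Lp.aestronglyMeasurable f)
  have h2 : ∫ s, ‖f s‖ ∂(timeMeasure S) = (eLpNorm f 1 (timeMeasure S)).toReal := by
    rw [eLpNorm_one_eq_lintegral_enorm,
      integral_norm_eq_lintegral_enorm (Lp.aestronglyMeasurable f)]
  rw [h2, Lp.norm_def, mul_comm]
  refine (ENNReal.toReal_mono (ENNReal.mul_ne_top (Lp.eLpNorm_ne_top f) ?_) h).trans_eq ?_
  · exact ENNReal.rpow_ne_top_of_nonneg (by norm_num) (measure_ne_top _ _)
  · rw [ENNReal.toReal_mul, ← ENNReal.toReal_rpow]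
    norm_num [Measure.real]

lemma continuousOn_primitive_L2Time {S : ℝ} (f : L2Time S E) :
    ContinuousOn (fun t => ∫ s in Ioc 0 t, f s) (Icc 0 S) :=
  intervalIntegral.continuousOn_primitive (by
    rw [integrableOn_Icc_iff_integrableOn_Ioc]; exact L2Time_integrableOn_Ioc f le_rfl)

/-- The primitive `t ↦ ∫₀ᵗ f`, as a bounded operator from `L²(0, S; E)` to `C([0, S]; E)`. -/
def timePrimitive (S : ℝ) (E : Type) [NormedAddCommGroup E] [InnerProductSpace ℝ E] :
    L2Time S E →L[ℝ] C(Icc (0 : ℝ) S, E) :=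
  LinearMap.mkContinuous
    { toFun := fun f => ⟨fun t => ∫ s in Ioc 0 (t : ℝ), f s,
        (continuousOn_primitive_L2Time f).domRestrict⟩
      map_add' := by
        intro f g
        ext t
        change ∫ s in Ioc 0 (t : ℝ), (f + g : L2Time S E) s
          = (∫ s in Ioc 0 (t : ℝ), f s) + ∫ s in Ioc 0 (t : ℝ), g s
        rw [← integral_add (L2Time_integrableOn_Ioc f t.2.2) (L2Time_integrableOn_Ioc g t.2.2)]
        exact integral_congr_ae (ae_Ioc_of_ae_timeMeasure t.2.2 (Lp.coeFn_add f g))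
      map_smul' := by
        intro c f
        ext t
        change ∫ s in Ioc 0 (t : ℝ), (c • f : L2Time S E) s = c • ∫ s in Ioc 0 (t : ℝ), f s
        rw [← integral_smul]
        exact integral_congr_ae (ae_Ioc_of_ae_timeMeasure t.2.2 (Lp.coeFn_smul c f)) }
    ((timeMeasure S).real univ ^ (1 / 2 : ℝ))
    (by
      intro f
      refine (ContinuousMap.norm_le _ (by positivity)).2 fun t => ?_
      refine le_trans ?_ (integral_norm_L2Time_le f)
      refine (norm_integral_le_integral_norm _).trans ?_
      exact integral_mono_measure (restrict_Ioc_le_timeMeasure t.2.2)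
        (Filter.Eventually.of_forall fun _ => norm_nonneg _) (L2Time_integrable f).norm)

lemma timePrimitive_apply {S : ℝ} (f : L2Time S E) (t : Icc (0 : ℝ) S) :
    timePrimitive S E f t = ∫ s in Ioc 0 (t : ℝ), f s := rfl

omit [InnerProductSpace ℝ E] in
lemma memLp_IccExtend {S : ℝ} (hS : 0 ≤ S) (u : C(Icc (0 : ℝ) S, E)) :
    MemLp (IccExtend hS u) 2 (timeMeasure S) :=
  MemLp.of_bound (u.continuous.Icc_extend').aestronglyMeasurable ‖u‖
    (Filter.Eventually.of_forall fun _ => u.norm_coe_le_norm _)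

/-- The embedding of `C([0, S]; E)` in `L²(0, S; E)`. -/
def continuousToL2Time {S : ℝ} (hS : 0 ≤ S) (E : Type) [NormedAddCommGroup E]
    [InnerProductSpace ℝ E] : C(Icc (0 : ℝ) S, E) →L[ℝ] L2Time S E :=
  LinearMap.mkContinuous
    { toFun := fun u => MemLp.toLp (IccExtend hS u) (memLp_IccExtend hS u)
      map_add' := fun _ _ => rfl
      map_smul' := fun _ _ => rfl }
    ((timeMeasure S).real univ ^ ((2 : ENNReal).toReal⁻¹))
    (by
      intro u
      refine Lp.norm_le_of_ae_bound (norm_nonneg u) ?_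
      filter_upwards [MemLp.coeFn_toLp (memLp_IccExtend hS u)] with s hs
      refine le_trans (le_of_eq (congrArg norm hs)) ?_
      exact u.norm_coe_le_norm _)

lemma coeFn_continuousToL2Time {S : ℝ} (hS : 0 ≤ S) (u : C(Icc (0 : ℝ) S, E)) :
    continuousToL2Time hS E u =ᵐ[timeMeasure S] IccExtend hS u :=
  MemLp.coeFn_toLp (memLp_IccExtend hS u)

lemma ae_mem_Ioo_timeMeasure (S : ℝ) : ∀ᵐ s ∂(timeMeasure S), s ∈ Ioo 0 S :=
  ae_restrict_mem measurableSet_Ioo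

/-- The Volterra operator `f ↦ (t ↦ ∫₀ᵗ f)` on `L²(0, S; E)`. -/
def volterra {S : ℝ} (hS : 0 ≤ S) (E : Type) [NormedAddCommGroup E] [InnerProductSpace ℝ E] :
    L2Time S E →L[ℝ] L2Time S E :=
  continuousToL2Time hS E ∘L timePrimitive S E

lemma coeFn_volterra {S : ℝ} (hS : 0 ≤ S) (f : L2Time S E) :
    ∀ᵐ s ∂(timeMeasure S), volterra hS E f s = ∫ r in Ioc 0 s, f r := by
  filter_upwards [coeFn_continuousToL2Time hS (timePrimitive S E f), ae_mem_Ioo_timeMeasure S]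
    with s hs hs'
  refine hs.trans ?_
  rw [IccExtend_of_mem hS _ (Ioo_subset_Icc_self hs'), timePrimitive_apply]

/-- The inner product of `L²(0, t; E)`, as a form on `L²(0, S; E)`. -/
def partialInner (t : ℝ) {S : ℝ} (f g : L2Time S E) : ℝ := ∫ s in Ioc 0 t, inner ℝ (f s) (g s)

/-- Restriction in time is a bounded operator, so bilinearity and continuity of the truncated form
are inherited from an honest inner product. -/
lemma partialInner_eq {S t : ℝ} (f g : L2Time S E) (ht : t ≤ S) :
    partialInner t f g = inner ℝ (LpToLpRestrictCLM ℝ E ℝ (timeMeasure S) 2 (Iic t) f)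
      (LpToLpRestrictCLM ℝ E ℝ (timeMeasure S) 2 (Iic t) g) := by
  have h : (timeMeasure S).restrict (Iic t) = volume.restrict (Ioc 0 t) := by
    rw [timeMeasure_eq_restrict_Ioc, Measure.restrict_restrict measurableSet_Iic]
    congr 1
    ext r; simp only [mem_inter_iff, mem_Iic, mem_Ioc]; grind
  rw [L2.inner_def, partialInner, ← h]
  refine integral_congr_ae ?_
  filter_upwards [LpToLpRestrictCLM_coeFn ℝ (Iic t) f, LpToLpRestrictCLM_coeFn ℝ (Iic t) g]
    with s h1 h2
  rw [h1, h2]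

lemma continuous_partialInner {X : Type} [TopologicalSpace X] {S t : ℝ} (ht : t ≤ S)
    {a b : X → L2Time S E} (ha : Continuous a) (hb : Continuous b) :
    Continuous fun x => partialInner t (a x) (b x) := by
  simp_rw [partialInner_eq _ _ ht]
  fun_prop

lemma partialInner_comm {S : ℝ} (t : ℝ) (f g : L2Time S E) :
    partialInner t f g = partialInner t g f := by
  simp only [partialInner, real_inner_comm]

lemma partialInner_self_nonneg {S : ℝ} (t : ℝ) (f : L2Time S E) : 0 ≤ partialInner t f f :=
  integral_nonneg fun _ => real_inner_self_nonneg

lemma partialInner_add_left {S t : ℝ} (ht : t ≤ S) (f f' g : L2Time S E) :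
    partialInner t (f + f') g = partialInner t f g + partialInner t f' g := by
  simp only [partialInner_eq _ _ ht, map_add, inner_add_left]

lemma partialInner_add_right {S t : ℝ} (ht : t ≤ S) (f g g' : L2Time S E) :
    partialInner t f (g + g') = partialInner t f g + partialInner t f g' := by
  simp only [partialInner_eq _ _ ht, map_add, inner_add_right]

lemma partialInner_sub_right {S t : ℝ} (ht : t ≤ S) (f g g' : L2Time S E) :
    partialInner t f (g - g') = partialInner t f g - partialInner t f g' := by
  simp only [partialInner_eq _ _ ht, map_sub, inner_sub_right]

lemma partialInner_final {S : ℝ} (f g : L2Time S E) : partialInner S f g = inner ℝ f g := by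
  rw [partialInner, L2.inner_def, ← timeMeasure_eq_restrict_Ioc]

lemma partialInner_self_le {S t : ℝ} (ht : t ≤ S) (f : L2Time S E) :
    partialInner t f f ≤ ‖f‖ ^ 2 := by
  rw [← real_inner_self_eq_norm_sq, L2.inner_def, partialInner]
  exact integral_mono_measure (restrict_Ioc_le_timeMeasure ht)
    (Filter.Eventually.of_forall fun _ => real_inner_self_nonneg) (L2.integrable_inner f f)

lemma partialInner_volterra [CompleteSpace E] {S : ℝ} (hS : 0 ≤ S) (t : Icc (0 : ℝ) S)
    (f g : L2Time S E) :
    partialInner t f (volterra hS E g) + partialInner t (volterra hS E f) g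
      = inner ℝ (timePrimitive S E f t) (timePrimitive S E g t) := by
  rw [timePrimitive_apply, timePrimitive_apply, ← integral_inner_primitive_add
    (L2Time_integrableOn_Ioc f t.2.2) (L2Time_integrableOn_Ioc g t.2.2)]
  refine congrArg₂ _ (integral_congr_ae ?_) (integral_congr_ae ?_)
  · filter_upwards [ae_Ioc_of_ae_timeMeasure t.2.2 (coeFn_volterra hS g)] with s hs
    rw [hs]
  · filter_upwards [ae_Ioc_of_ae_timeMeasure t.2.2 (coeFn_volterra hS f)] with s hs
    rw [hs]

/-- The integrated form of d/dt |∫f|² = 2 (f, ∫f), the source of every energy identity below. -/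
lemma partialInner_volterra_self [CompleteSpace E] {S : ℝ} (hS : 0 ≤ S) (t : Icc (0 : ℝ) S)
    (f : L2Time S E) :
    2 * partialInner t f (volterra hS E f) = ‖timePrimitive S E f t‖ ^ 2 := by
  have h := partialInner_volterra hS t f f
  rw [partialInner_comm t (volterra hS E f), real_inner_self_eq_norm_sq] at h
  linarith

/-- Pointwise composition of an `L²(0, S; E)` function with a bounded operator. -/
abbrev timeMap (S : ℝ) (L : E →L[ℝ] F) : L2Time S E →L[ℝ] L2Time S F :=
  L.compLpL 2 (timeMeasure S)

lemma coeFn_timeMap {S : ℝ} (L : E →L[ℝ] F) (f : L2Time S E) :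
    ∀ᵐ s ∂(timeMeasure S), timeMap S L f s = L (f s) := L.coeFn_compLpL f

lemma timePrimitive_timeMap [CompleteSpace E] [CompleteSpace F] {S : ℝ} (L : E →L[ℝ] F)
    (f : L2Time S E) (t : Icc (0 : ℝ) S) :
    timePrimitive S F (timeMap S L f) t = L (timePrimitive S E f t) := by
  rw [timePrimitive_apply, timePrimitive_apply,
    ← L.integral_comp_comm (L2Time_integrableOn_Ioc f t.2.2)]
  exact integral_congr_ae (ae_Ioc_of_ae_timeMeasure t.2.2 (coeFn_timeMap L f))

lemma volterra_timeMap [CompleteSpace E] [CompleteSpace F] {S : ℝ} (hS : 0 ≤ S) (L : E →L[ℝ] F)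
    (f : L2Time S E) :
    volterra hS F (timeMap S L f) = timeMap S L (volterra hS E f) := by
  refine Lp.ext ?_
  filter_upwards [coeFn_volterra hS (timeMap S L f), coeFn_timeMap L (volterra hS E f),
    coeFn_volterra hS f, ae_mem_Ioo_timeMeasure S] with s h1 h2 h3 h4
  rw [h1, h2, h3]
  exact timePrimitive_timeMap L f ⟨s, Ioo_subset_Icc_self h4⟩

lemma partialInner_timeMap_left [CompleteSpace E] [CompleteSpace F] {S t : ℝ} (ht : t ≤ S)
    (L : E →L[ℝ] F) (f : L2Time S E) (g : L2Time S F) :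
    partialInner t (timeMap S L f) g = partialInner t f (timeMap S L.adjoint g) := by
  refine integral_congr_ae ?_
  filter_upwards [ae_Ioc_of_ae_timeMeasure ht (coeFn_timeMap L f),
    ae_Ioc_of_ae_timeMeasure ht (coeFn_timeMap L.adjoint g)] with s h1 h2
  rw [h1, h2, ContinuousLinearMap.adjoint_inner_right]

lemma inner_timeMap_left [CompleteSpace E] [CompleteSpace F] {S : ℝ}
    (L : E →L[ℝ] F) (f : L2Time S E) (g : L2Time S F) :
    inner ℝ (timeMap S L f) g = inner ℝ f (timeMap S L.adjoint g) := by
  rw [← partialInner_final, ← partialInner_final, partialInner_timeMap_left le_rfl]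

lemma adjoint_timeMap [CompleteSpace E] [CompleteSpace F] {S : ℝ} (L : E →L[ℝ] F) :
    (timeMap S L).adjoint = timeMap S L.adjoint :=
  ((ContinuousLinearMap.eq_adjoint_iff _ _).2 fun f g => by
    rw [inner_timeMap_left, ContinuousLinearMap.adjoint_adjoint]).symm

lemma timeMap_injective {S : ℝ} {L : E →L[ℝ] F} (hL : Function.Injective L) {f : L2Time S E}
    (hf : timeMap S L f = 0) : f = 0 := by
  refine Lp.ext ?_
  have h := coeFn_timeMap L f
  rw [hf] at h
  filter_upwards [h, Lp.coeFn_zero F 2 (timeMeasure S), Lp.coeFn_zero E 2 (timeMeasure S)]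
    with s h1 h2 h3
  refine hL ?_
  rw [← h1, h2, h3, Pi.zero_apply, Pi.zero_apply, map_zero]

/-! ### Time reflection and the adjoint of the Volterra operator -/

lemma measurePreserving_reflect (S : ℝ) :
    MeasurePreserving (fun s => S - s) (timeMeasure S) (timeMeasure S) := by
  have h := (Measure.measurePreserving_sub_left (volume : Measure ℝ) S).restrict_preimage
    (s := Ioo 0 S) measurableSet_Ioo
  have e : (fun s => S - s) ⁻¹' Ioo 0 S = Ioo 0 S := by
    ext s; simp only [mem_preimage, mem_Ioo]; grind
  rwa [e] at h

/-- The time reflection `s ↦ S - s` on `L²(0, S; E)`. -/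
def timeReverse (S : ℝ) (E : Type) [NormedAddCommGroup E] [InnerProductSpace ℝ E] :
    L2Time S E →L[ℝ] L2Time S E :=
  (Lp.compMeasurePreservingₗᵢ ℝ (fun s => S - s)
    (measurePreserving_reflect S)).toContinuousLinearMap

lemma coeFn_timeReverse {S : ℝ} (f : L2Time S E) :
    ∀ᵐ s ∂(timeMeasure S), timeReverse S E f s = f (S - s) :=
  Lp.coeFn_compMeasurePreserving f (measurePreserving_reflect S)

lemma timeReverse_timeReverse {S : ℝ} (f : L2Time S E) :
    timeReverse S E (timeReverse S E f) = f := by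
  refine Lp.ext ?_
  filter_upwards [coeFn_timeReverse (timeReverse S E f),
    (measurePreserving_reflect S).quasiMeasurePreserving.ae (coeFn_timeReverse f)] with s h1 h2
  rw [h1, h2, sub_sub_cancel]

lemma timeReverse_timeMap {S : ℝ} (L : E →L[ℝ] F) (f : L2Time S E) :
    timeReverse S F (timeMap S L f) = timeMap S L (timeReverse S E f) := by
  refine Lp.ext ?_
  filter_upwards [coeFn_timeReverse (timeMap S L f), coeFn_timeMap L (timeReverse S E f),
    coeFn_timeReverse f,
    (measurePreserving_reflect S).quasiMeasurePreserving.ae (coeFn_timeMap L f)] with s h1 h2 h3 h4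
  rw [h1, h2, h3, h4]

/-- Conjugating by the reflection turns ∫₀ˢ into the integral from s to S, and the two add up to the
total integral. -/
lemma volterra_add_reverse [CompleteSpace E] {S : ℝ} (hS : 0 ≤ S) (f : L2Time S E) :
    volterra hS E f + timeReverse S E (volterra hS E (timeReverse S E f))
      = continuousToL2Time hS E (ContinuousMap.const _
          (timePrimitive S E f ⟨S, hS, le_rfl⟩)) := by
  refine Lp.ext ?_
  filter_upwards [Lp.coeFn_add (volterra hS E f)
      (timeReverse S E (volterra hS E (timeReverse S E f))), coeFn_volterra hS f,
    coeFn_timeReverse (volterra hS E (timeReverse S E f)),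
    (measurePreserving_reflect S).quasiMeasurePreserving.ae
      (coeFn_volterra hS (timeReverse S E f)), ae_mem_Ioo_timeMeasure S,
    coeFn_continuousToL2Time hS (ContinuousMap.const _ (timePrimitive S E f ⟨S, hS, le_rfl⟩))]
    with s h1 h2 h3 h4 h5 h6
  rw [h1, Pi.add_apply, h2, h3, h4, h6]
  change _ = timePrimitive S E f ⟨S, hS, le_rfl⟩
  rw [timePrimitive_apply]
  have h7 : ∫ r in Ioc 0 (S - s), timeReverse S E f r = ∫ r in Ioc s S, f r := by
    have : ∫ r in Ioc 0 (S - s), timeReverse S E f r = ∫ r in Ioc 0 (S - s), f (S - r) :=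
      integral_congr_ae (ae_Ioc_of_ae_timeMeasure (by linarith [h5.1]) (coeFn_timeReverse f))
    rw [this, ← intervalIntegral.integral_of_le (by linarith [h5.2]),
      ← intervalIntegral.integral_of_le h5.2.le,
      intervalIntegral.integral_comp_sub_left (fun r => f r) S]
    congr 1 <;> ring
  rw [h7, ← setIntegral_union (by
      rw [Set.disjoint_left]; intro r hr hr'; exact absurd hr.2 (not_le.2 hr'.1))
    measurableSet_Ioc (L2Time_integrableOn_Ioc f h5.2.le)
    ((L2Time_integrableOn_Ioc f le_rfl).mono_set (Ioc_subset_Ioc_left h5.1.le)),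
    Ioc_union_Ioc_eq_Ioc h5.1.le h5.2.le]

lemma inner_continuousToL2Time_const [CompleteSpace E] {S : ℝ} (hS : 0 ≤ S) (f : L2Time S E)
    (c : E) : inner ℝ f (continuousToL2Time hS E (ContinuousMap.const _ c))
      = inner ℝ (timePrimitive S E f ⟨S, hS, le_rfl⟩) c := by
  rw [L2.inner_def, timePrimitive_apply, real_inner_comm,
    ← integral_inner (L2Time_integrableOn_Ioc f le_rfl), ← timeMeasure_eq_restrict_Ioc]
  refine integral_congr_ae ?_
  filter_upwards [coeFn_continuousToL2Time hS (ContinuousMap.const _ c)] with s hs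
  rw [hs, real_inner_comm]
  rfl

/-- In the integration by parts at t = S the boundary term is f paired with the constant function
∫₀ˢg, taken at s = S; subtracting ∫g from this constant leaves the backward primitive. -/
lemma inner_volterra_left [CompleteSpace E] {S : ℝ} (hS : 0 ≤ S) (f g : L2Time S E) :
    inner ℝ (volterra hS E f) g
      = inner ℝ f (timeReverse S E (volterra hS E (timeReverse S E g))) := by
  have h1 := partialInner_volterra hS ⟨S, hS, le_rfl⟩ f g
  rw [partialInner_final, partialInner_final] at h1
  have h2 := congrArg (inner ℝ f) (volterra_add_reverse hS g)
  rw [inner_add_right, inner_continuousToL2Time_const] at h2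
  linarith

end TimeIntegral

/-! ### The unperturbed equation in a Hilbert triple: maximal regularity -/

section ParabolicFlow

variable {V H : Type} [NormedAddCommGroup V] [InnerProductSpace ℝ V] [CompleteSpace V]
  [NormedAddCommGroup H] [InnerProductSpace ℝ H] [CompleteSpace H]

lemma denseRange_of_adjoint_injective {j : V →L[ℝ] H} (hj : Function.Injective j.adjoint) :
    DenseRange j := by
  have h := (Submodule.topologicalClosure_eq_top_iff (K := j.range)).2 (by
    rw [ContinuousLinearMap.orthogonal_range]
    exact LinearMap.ker_eq_bot.2 hj)
  rw [← Submodule.dense_iff_topologicalClosure_eq_top] at h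
  exact h

/-- For a Hilbert triple `V ⊂ H ⊂ V'` with inclusion `j`, let `Λ` be the operator of the form
`(·, ·)_V`, so that `Λ⁻¹ = j j†`. The operator `h ↦ Λ⁻¹ h + ∫₀ᵗ h` sends `h = ∂ₜ Λ v` to
`∂ₜ v + Λ v`. -/
def parabolicOp {S : ℝ} (hS : 0 ≤ S) (j : V →L[ℝ] H) : L2Time S H →L[ℝ] L2Time S H :=
  timeMap S (j ∘L j.adjoint) + volterra hS H

lemma timeMap_comp_apply {E F G : Type} [NormedAddCommGroup E] [InnerProductSpace ℝ E]
    [NormedAddCommGroup F] [InnerProductSpace ℝ F] [NormedAddCommGroup G] [InnerProductSpace ℝ G]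
    {S : ℝ} (L : F →L[ℝ] G) (M : E →L[ℝ] F) (f : L2Time S E) :
    timeMap S (L ∘L M) f = timeMap S L (timeMap S M f) := by
  refine Lp.ext ?_
  filter_upwards [coeFn_timeMap (L ∘L M) f, coeFn_timeMap L (timeMap S M f), coeFn_timeMap M f]
    with s h1 h2 h3
  rw [h1, h2, h3]
  rfl

variable {S : ℝ} (hS : 0 ≤ S) {j : V →L[ℝ] H}

lemma parabolicOp_apply (j : V →L[ℝ] H) (h : L2Time S H) :
    parabolicOp hS j h = timeMap S j (timeMap S j.adjoint h) + volterra hS H h := by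
  rw [parabolicOp, add_apply, timeMap_comp_apply]

/-- With v = ∫j†h this reads 2 ∫(∂ₜv, Λv)_H = ‖v(t)‖²_V: moving j to the other side replaces Λv by
j†∫h = v. -/
lemma two_mul_partialInner_elliptic (j : V →L[ℝ] H) (h : L2Time S H) (t : Icc (0 : ℝ) S) :
    2 * partialInner t (timeMap S j (timeMap S j.adjoint h)) (volterra hS H h)
      = ‖timePrimitive S V (timeMap S j.adjoint h) t‖ ^ 2 := by
  rw [partialInner_timeMap_left t.2.2, ← volterra_timeMap, partialInner_volterra_self]

/-- If g is killed by the adjoint of P = `parabolicOp hS j`, then 0 = (g, Pg) = ‖j†g‖² + ½|∫g|², so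
j†g = 0 and g = 0. -/
lemma denseRange_parabolicOp (hj : Function.Injective j.adjoint) :
    DenseRange (parabolicOp hS j) := by
  refine denseRange_of_adjoint_injective ((injective_iff_map_eq_zero _).2 fun g hg => ?_)
  have h1 : inner ℝ g (parabolicOp hS j g) = 0 := by
    rw [← ContinuousLinearMap.adjoint_inner_left, hg, inner_zero_left]
  rw [parabolicOp_apply, inner_add_right] at h1
  have h2 := partialInner_volterra_self hS ⟨S, hS, le_rfl⟩ g
  rw [partialInner_final] at h2
  have h3 : inner ℝ g (timeMap S j (timeMap S j.adjoint g)) = ‖timeMap S j.adjoint g‖ ^ 2 := by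
    rw [real_inner_comm, inner_timeMap_left, real_inner_self_eq_norm_sq]
  have h4 : ‖timeMap S j.adjoint g‖ ^ 2 = 0 := by
    nlinarith [sq_nonneg ‖timeMap S j.adjoint g‖,
      sq_nonneg ‖timePrimitive S H g ⟨S, hS, le_rfl⟩‖]
  exact timeMap_injective hj (norm_eq_zero.1 (pow_eq_zero_iff two_ne_zero |>.1 h4))

/-- The maximal regularity identity: |∂ₜv + Λv|² splits into |∂ₜv|², |Λv|² and an exact derivative.
Both extensions by density below rest on it. -/
lemma partialInner_parabolicOp (j : V →L[ℝ] H) (h : L2Time S H) (t : Icc (0 : ℝ) S) :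
    partialInner t (parabolicOp hS j h) (parabolicOp hS j h)
      = partialInner t (timeMap S j (timeMap S j.adjoint h)) (timeMap S j (timeMap S j.adjoint h))
        + partialInner t (volterra hS H h) (volterra hS H h)
        + ‖timePrimitive S V (timeMap S j.adjoint h) t‖ ^ 2 := by
  rw [← two_mul_partialInner_elliptic hS, parabolicOp_apply, partialInner_add_left t.2.2,
    partialInner_add_right t.2.2, partialInner_add_right t.2.2,
    partialInner_comm t (volterra hS H h) (timeMap S j _)]
  ring

lemma sq_norm_primitive_le_partialInner (j : V →L[ℝ] H) (h : L2Time S H) (t : Icc (0 : ℝ) S) :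
    ‖timePrimitive S V (timeMap S j.adjoint h) t‖ ^ 2
      ≤ partialInner t (parabolicOp hS j h) (parabolicOp hS j h) := by
  rw [partialInner_parabolicOp]
  linarith [partialInner_self_nonneg (t : ℝ) (timeMap S j (timeMap S j.adjoint h)),
    partialInner_self_nonneg (t : ℝ) (volterra hS H h)]

lemma norm_primitive_le (j : V →L[ℝ] H) (h : L2Time S H) :
    ‖(timePrimitive S V ∘L timeMap S j.adjoint) h‖ ≤ 1 * ‖parabolicOp hS j h‖ := by
  refine (ContinuousMap.norm_le _ (by positivity)).2 fun t => ?_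
  rw [one_mul]
  refine le_of_sq_le_sq ?_ (norm_nonneg _)
  exact (sq_norm_primitive_le_partialInner hS j h t).trans (partialInner_self_le t.2.2 _)

lemma norm_volterra_le (j : V →L[ℝ] H) (h : L2Time S H) :
    ‖volterra hS H h‖ ≤ 1 * ‖parabolicOp hS j h‖ := by
  rw [one_mul]
  refine le_of_sq_le_sq ?_ (norm_nonneg _)
  have h1 := partialInner_parabolicOp hS j h ⟨S, hS, le_rfl⟩
  simp only [partialInner_final, real_inner_self_eq_norm_sq] at h1
  rw [h1]
  nlinarith [sq_nonneg ‖timeMap S j (timeMap S j.adjoint h)‖,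
    sq_nonneg ‖timePrimitive S V (timeMap S j.adjoint h) ⟨S, hS, le_rfl⟩‖]

/-- The solution operator `g ↦ v` of `∂ₜ v + Λ v = g`, `v(0) = 0`, from `L²(0, S; H)` to
`C([0, S]; V)`. -/
def parabolicFlow (j : V →L[ℝ] H) : L2Time S H →L[ℝ] C(Icc (0 : ℝ) S, V) :=
  (timePrimitive S V ∘L timeMap S j.adjoint).toLinearMap.extendOfNorm
    (parabolicOp hS j).toLinearMap

/-- The operator `g ↦ Λ v`, where `∂ₜ v + Λ v = g`, `v(0) = 0`. -/
def ellipticPart (j : V →L[ℝ] H) : L2Time S H →L[ℝ] L2Time S H :=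
  (volterra hS H).toLinearMap.extendOfNorm (parabolicOp hS j).toLinearMap

lemma parabolicFlow_parabolicOp (hj : Function.Injective j.adjoint) (h : L2Time S H) :
    parabolicFlow hS j (parabolicOp hS j h) = timePrimitive S V (timeMap S j.adjoint h) :=
  LinearMap.extendOfNorm_eq (denseRange_parabolicOp hS hj) ⟨1, norm_primitive_le hS j⟩ h

lemma ellipticPart_parabolicOp (hj : Function.Injective j.adjoint) (h : L2Time S H) :
    ellipticPart hS j (parabolicOp hS j h) = volterra hS H h :=
  LinearMap.extendOfNorm_eq (denseRange_parabolicOp hS hj) ⟨1, norm_volterra_le hS j⟩ h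

/-- This is v = Λ⁻¹(Λv); on the dense range it says that j† commutes with primitives. -/
lemma continuousToL2Time_parabolicFlow (hj : Function.Injective j.adjoint) (g : L2Time S H) :
    continuousToL2Time hS V (parabolicFlow hS j g) = timeMap S j.adjoint (ellipticPart hS j g) := by
  refine (denseRange_parabolicOp hS hj).induction_on
    (p := fun g => continuousToL2Time hS V (parabolicFlow hS j g)
      = timeMap S j.adjoint (ellipticPart hS j g)) g
    (isClosed_eq (by fun_prop) (by fun_prop)) fun h => ?_
  rw [parabolicFlow_parabolicOp hS hj, ellipticPart_parabolicOp hS hj, ← volterra_timeMap]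
  rfl

lemma map_parabolicFlow (hj : Function.Injective j.adjoint) (g : L2Time S H)
    (t : Icc (0 : ℝ) S) :
    j (parabolicFlow hS j g t) = timePrimitive S H (g - ellipticPart hS j g) t := by
  refine (denseRange_parabolicOp hS hj).induction_on
    (p := fun g => j (parabolicFlow hS j g t) = timePrimitive S H (g - ellipticPart hS j g) t) g
    (isClosed_eq (by fun_prop) (by fun_prop)) fun h => ?_
  rw [parabolicFlow_parabolicOp hS hj, ellipticPart_parabolicOp hS hj, parabolicOp_apply,
    add_sub_cancel_right, timePrimitive_timeMap j]

lemma sq_norm_parabolicFlow (hj : Function.Injective j.adjoint) (g : L2Time S H)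
    (t : Icc (0 : ℝ) S) :
    ‖parabolicFlow hS j g t‖ ^ 2
      = 2 * partialInner t (g - ellipticPart hS j g) (ellipticPart hS j g) := by
  refine (denseRange_parabolicOp hS hj).induction_on
    (p := fun g => ‖parabolicFlow hS j g t‖ ^ 2
      = 2 * partialInner t (g - ellipticPart hS j g) (ellipticPart hS j g)) g
    (isClosed_eq (by fun_prop) (continuous_const.mul
      (continuous_partialInner t.2.2 (by fun_prop) (by fun_prop)))) fun h => ?_
  rw [parabolicFlow_parabolicOp hS hj, ellipticPart_parabolicOp hS hj, parabolicOp_apply,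
    add_sub_cancel_right, two_mul_partialInner_elliptic]

/-- The inequality 2(a, b) ≤ |a + b|² with a = ∂ₜv, b = Λv. Only g on (0,t) appears on the right;
this causality drives the iteration for the perturbed problem. -/
lemma sq_norm_parabolicFlow_le (hj : Function.Injective j.adjoint) (g : L2Time S H)
    (t : Icc (0 : ℝ) S) :
    ‖parabolicFlow hS j g t‖ ^ 2 ≤ partialInner t g g := by
  rw [sq_norm_parabolicFlow hS hj]
  have h1 := partialInner_self_nonneg (t : ℝ) (g - ellipticPart hS j g - ellipticPart hS j g)
  have h2 := partialInner_self_nonneg (t : ℝ) (g - ellipticPart hS j g)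
  have h3 := partialInner_self_nonneg (t : ℝ) (ellipticPart hS j g)
  have h4 : partialInner t g g = partialInner t ((g - ellipticPart hS j g) + ellipticPart hS j g)
    ((g - ellipticPart hS j g) + ellipticPart hS j g) := by rw [sub_add_cancel]
  rw [partialInner_add_left t.2.2, partialInner_add_right t.2.2, partialInner_add_right t.2.2,
    partialInner_comm t (ellipticPart hS j g) (g - ellipticPart hS j g)] at h4
  linarith

lemma parabolicFlow_zero (hj : Function.Injective j.adjoint) (g : L2Time S H) :
    parabolicFlow hS j g ⟨0, le_rfl, hS⟩ = 0 := by
  have h := sq_norm_parabolicFlow_le hS hj g ⟨0, le_rfl, hS⟩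
  have h0 : partialInner 0 g g = 0 := by simp [partialInner]
  rw [h0] at h
  exact norm_eq_zero.1 (pow_eq_zero_iff two_ne_zero |>.1 (le_antisymm h (sq_nonneg _)))

/-- The integrated form of `∂ₜ v + Λ v = g`, `v(0) = 0`. -/
lemma parabolicFlow_integrated (hj : Function.Injective j.adjoint) (g : L2Time S H)
    (t : Icc (0 : ℝ) S) :
    j.adjoint (j (parabolicFlow hS j g t))
      + timePrimitive S V (continuousToL2Time hS V (parabolicFlow hS j g)) t
      = j.adjoint (timePrimitive S H g t) := by
  rw [map_parabolicFlow hS hj, continuousToL2Time_parabolicFlow hS hj,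
    timePrimitive_timeMap j.adjoint, ← map_add, map_sub, ContinuousMap.sub_apply, sub_add_cancel]

/-- The difference w of two solutions satisfies j†jw + ∫w = 0; pairing with w gives ‖jw‖² + ½‖∫w‖² =
0. -/
lemma eq_parabolicFlow_of_integrated (hj : Function.Injective j)
    (hj' : Function.Injective j.adjoint) (g : L2Time S H) (v : L2Time S V)
    (hv : ∀ᵐ t ∂(timeMeasure S), j.adjoint (j (v t)) + ∫ s in Ioc 0 t, v s
      = j.adjoint (∫ s in Ioc 0 t, g s)) :
    v = continuousToL2Time hS V (parabolicFlow hS j g) := by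
  set v' := continuousToL2Time hS V (parabolicFlow hS j g) with hv'
  have h1 : timeMap S j.adjoint (timeMap S j (v - v')) + volterra hS V (v - v') = 0 := by
    rw [map_sub, map_sub, map_sub, sub_add_sub_comm, sub_eq_zero]
    refine Lp.ext ?_
    filter_upwards [Lp.coeFn_add (timeMap S j.adjoint (timeMap S j v)) (volterra hS V v),
      Lp.coeFn_add (timeMap S j.adjoint (timeMap S j v')) (volterra hS V v'),
      coeFn_timeMap j.adjoint (timeMap S j v), coeFn_timeMap j.adjoint (timeMap S j v'),
      coeFn_timeMap j v, coeFn_timeMap j v', coeFn_volterra hS v, coeFn_volterra hS v', hv,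
      coeFn_continuousToL2Time hS (parabolicFlow hS j g), ae_mem_Ioo_timeMeasure S]
      with t e1 e2 e3 e4 e5 e6 e7 e8 e9 e10 e11
    rw [e1, e2, Pi.add_apply, Pi.add_apply, e3, e4, e5, e6, e7, e8, e9, hv', e10,
      IccExtend_of_mem hS _ (Ioo_subset_Icc_self e11)]
    exact (parabolicFlow_integrated hS hj' g ⟨t, Ioo_subset_Icc_self e11⟩).symm
  have h2 := congrArg (inner ℝ (v - v')) h1
  rw [inner_add_right, inner_zero_right, ← inner_timeMap_left, real_inner_self_eq_norm_sq] at h2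
  have h3 := partialInner_volterra_self hS ⟨S, hS, le_rfl⟩ (v - v')
  rw [partialInner_final] at h3
  have h4 : ‖timeMap S j (v - v')‖ ^ 2 = 0 := by
    nlinarith [sq_nonneg ‖timeMap S j (v - v')‖,
      sq_nonneg ‖timePrimitive S V (v - v') ⟨S, hS, le_rfl⟩‖]
  exact sub_eq_zero.1 (timeMap_injective hj (norm_eq_zero.1 (pow_eq_zero_iff two_ne_zero |>.1 h4)))

/-- Tested on the dense range in both arguments: j j† is self-adjoint and commutes with primitives
and with the reflection, while the adjoint of the Volterra operator is its reflected conjugate. -/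
lemma adjoint_ellipticPart (hj : Function.Injective j.adjoint) (g : L2Time S H) :
    (ellipticPart hS j).adjoint g
      = timeReverse S H (ellipticPart hS j (timeReverse S H g)) := by
  have key : ∀ f g : L2Time S H, inner ℝ (ellipticPart hS j f) (timeReverse S H g)
      = inner ℝ f (timeReverse S H (ellipticPart hS j g)) := by
    intro f g
    refine (denseRange_parabolicOp hS hj).induction_on₂
      (p := fun f g => inner ℝ (ellipticPart hS j f) (timeReverse S H g)
        = inner ℝ f (timeReverse S H (ellipticPart hS j g)))
      (isClosed_eq (by fun_prop) (by fun_prop)) (fun h k => ?_) f g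
    rw [ellipticPart_parabolicOp hS hj, ellipticPart_parabolicOp hS hj, parabolicOp_apply,
      parabolicOp_apply, map_add, inner_add_right, inner_add_left, inner_volterra_left hS h
        (timeReverse S H (timeMap S j (timeMap S j.adjoint k))), timeReverse_timeReverse,
      volterra_timeMap, volterra_timeMap, timeReverse_timeMap, timeReverse_timeMap]
    congr 1
    rw [real_inner_comm, inner_timeMap_left, inner_timeMap_left,
      ContinuousLinearMap.adjoint_adjoint, real_inner_comm]
  refine ext_inner_left ℝ fun f => ?_
  rw [ContinuousLinearMap.adjoint_inner_right, ← key, timeReverse_timeReverse]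

/-! ### Lower order perturbations -/

/-- The perturbation `C (∂ₜ + Λ)⁻¹` of the identity of `L²(0, S; H)`. -/
def perturbOp (j : V →L[ℝ] H) (C : L2Time S V →L[ℝ] L2Time S H) : L2Time S H →L[ℝ] L2Time S H :=
  C ∘L continuousToL2Time hS V ∘L parabolicFlow hS j

/-- Since C acts with a bound at almost every time and the flow estimate is causal, each application
costs c² and gains one integration in t. The iterated integrals produce the factorial. -/
lemma partialInner_perturbOp_pow_le (hj : Function.Injective j.adjoint)
    {C : L2Time S V →L[ℝ] L2Time S H} {c : ℝ}
    (hC : ∀ v, ∀ᵐ s ∂(timeMeasure S), ‖C v s‖ ≤ c * ‖v s‖) (g : L2Time S H) (n : ℕ) :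
    ∀ t : Icc (0 : ℝ) S, partialInner t ((perturbOp hS j C ^ n) g) ((perturbOp hS j C ^ n) g)
      ≤ (c ^ 2 * t) ^ n / n.factorial * ‖g‖ ^ 2 := by
  induction n with
  | zero => intro t; simpa using partialInner_self_le t.2.2 g
  | succ n ih =>
    intro t
    rw [pow_succ']
    set x := (perturbOp hS j C ^ n) g with hx
    change partialInner t (C (continuousToL2Time hS V (parabolicFlow hS j x)))
      (C (continuousToL2Time hS V (parabolicFlow hS j x))) ≤ _
    set y := continuousToL2Time hS V (parabolicFlow hS j x) with hy
    have h1 : partialInner t (C y) (C y)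
        ≤ ∫ s in Ioc 0 (t : ℝ), c ^ 2 * ((c ^ 2 * s) ^ n / n.factorial * ‖g‖ ^ 2) := by
      refine integral_mono_ae ?_ ?_ ?_
      · exact (L2.integrable_inner (𝕜 := ℝ) (C y) (C y)).mono_measure
          (restrict_Ioc_le_timeMeasure t.2.2)
      · refine Continuous.integrableOn_Ioc ?_
        fun_prop
      · filter_upwards [ae_Ioc_of_ae_timeMeasure t.2.2 (hC y), ae_Ioc_of_ae_timeMeasure t.2.2
          (coeFn_continuousToL2Time hS (parabolicFlow hS j x)), ae_restrict_mem measurableSet_Ioc]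
          with s h1 h2 h3
        have hs : s ∈ Icc (0 : ℝ) S := ⟨h3.1.le, h3.2.trans t.2.2⟩
        rw [real_inner_self_eq_norm_sq]
        rw [hy, h2, IccExtend_of_mem hS _ hs] at h1
        calc ‖C y s‖ ^ 2 ≤ (c * ‖parabolicFlow hS j x ⟨s, hs⟩‖) ^ 2 :=
              pow_le_pow_left₀ (norm_nonneg _) h1 2
          _ = c ^ 2 * ‖parabolicFlow hS j x ⟨s, hs⟩‖ ^ 2 := by ring
          _ ≤ _ := by
              gcongr
              exact (sq_norm_parabolicFlow_le hS hj x ⟨s, hs⟩).trans (ih ⟨s, hs⟩)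
    refine h1.trans_eq ?_
    have h2 : ∀ s : ℝ, c ^ 2 * ((c ^ 2 * s) ^ n / n.factorial * ‖g‖ ^ 2)
        = ((c ^ 2) ^ (n + 1) / n.factorial * ‖g‖ ^ 2) * s ^ n := fun s => by
      rw [mul_pow, pow_succ]; ring
    simp_rw [h2]
    rw [integral_const_mul, ← intervalIntegral.integral_of_le t.2.1, integral_pow,
      Nat.factorial_succ, mul_pow]
    push_cast
    field_simp
    simp

lemma isUnit_one_sub_perturbOp (hj : Function.Injective j.adjoint)
    {C : L2Time S V →L[ℝ] L2Time S H} {c : ℝ}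
    (hC : ∀ v, ∀ᵐ s ∂(timeMeasure S), ‖C v s‖ ≤ c * ‖v s‖) :
    IsUnit (1 - perturbOp hS j C) := by
  -- The iterates are estimated in squared norm, so 1/4 here gives operator norm at most 1/2.
  obtain ⟨n, hn⟩ := ((FloorSemiring.tendsto_pow_div_factorial_atTop (c ^ 2 * S)).eventually
    (gt_mem_nhds (show (0 : ℝ) < 1 / 4 by norm_num))).exists
  have h1 : ‖perturbOp hS j C ^ n‖ ≤ 1 / 2 := by
    refine ContinuousLinearMap.opNorm_le_bound _ (by norm_num) fun g => ?_
    refine le_of_sq_le_sq ?_ (by positivity)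
    have h2 := partialInner_perturbOp_pow_le hS hj hC g n ⟨S, hS, le_rfl⟩
    rw [partialInner_final, real_inner_self_eq_norm_sq] at h2
    refine h2.trans ?_
    rw [mul_pow (1 / 2 : ℝ) ‖g‖]
    refine mul_le_mul_of_nonneg_right ?_ (sq_nonneg _)
    norm_num at hn ⊢
    exact hn.le
  have h2 : IsUnit (1 - perturbOp hS j C ^ n) :=
    isUnit_one_sub_of_norm_lt_one (x := perturbOp hS j C ^ n) (h1.trans_lt (by norm_num))
  -- 1 - T is a factor of 1 - Tⁿ, and commutes with the cofactor ∑ Tⁱ; a factor of a unit in a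
  -- commuting product is a unit.
  rw [← mul_neg_geom_sum] at h2
  refine ((Commute.isUnit_mul_iff ?_).1 h2).1
  refine Commute.sum_right _ _ _ fun i _ => ?_
  exact ((Commute.one_left _).sub_left (Commute.refl _)).pow_right i

lemma isUnit_one_add_perturbOp (hj : Function.Injective j.adjoint)
    {C : L2Time S V →L[ℝ] L2Time S H} {c : ℝ}
    (hC : ∀ v, ∀ᵐ s ∂(timeMeasure S), ‖C v s‖ ≤ c * ‖v s‖) :
    IsUnit (1 + perturbOp hS j C) := by
  have h := isUnit_one_sub_perturbOp hS hj (C := -C) (c := c) (fun v => by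
    filter_upwards [hC v, Lp.coeFn_neg (C v)] with s h1 h2
    rw [neg_apply, h2, Pi.neg_apply, norm_neg]
    exact h1)
  have e : perturbOp hS j (-C) = -perturbOp hS j C := by
    simp only [perturbOp, ContinuousLinearMap.neg_comp]
  rwa [e, sub_neg_eq_add] at h

/-- The operator sending `φ` to the source `g = φ - C v`, where `v` solves
`∂ₜ v + Λ v + C v = φ`, `v(0) = 0`. -/
def perturbInverse (j : V →L[ℝ] H) (C : L2Time S V →L[ℝ] L2Time S H) :
    L2Time S H →L[ℝ] L2Time S H :=
  Ring.inverse (1 + perturbOp hS j C)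

/-- The solution operator `φ ↦ v` of `∂ₜ v + Λ v + C v = φ`, `v(0) = 0`. -/
def perturbedFlow (j : V →L[ℝ] H) (C : L2Time S V →L[ℝ] L2Time S H) :
    L2Time S H →L[ℝ] C(Icc (0 : ℝ) S, V) :=
  parabolicFlow hS j ∘L perturbInverse hS j C

variable {C : L2Time S V →L[ℝ] L2Time S H} {c : ℝ}

lemma perturbInverse_eq_sub (hj : Function.Injective j.adjoint)
    (hC : ∀ v, ∀ᵐ s ∂(timeMeasure S), ‖C v s‖ ≤ c * ‖v s‖) (φ : L2Time S H) :
    perturbInverse hS j C φ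
      = φ - C (continuousToL2Time hS V (perturbedFlow hS j C φ)) := by
  have h := congrArg (fun L : L2Time S H →L[ℝ] L2Time S H => L φ)
    (Ring.mul_inverse_cancel _ (isUnit_one_add_perturbOp hS hj hC))
  exact eq_sub_of_add_eq h

/-- Absorb Cv into the source: v is the unperturbed flow of g = φ - Cv, hence (1 + T)g = φ, and
invertibility determines g. -/
lemma eq_perturbedFlow_of_integrated (hj : Function.Injective j)
    (hj' : Function.Injective j.adjoint)
    (hC : ∀ v, ∀ᵐ s ∂(timeMeasure S), ‖C v s‖ ≤ c * ‖v s‖) (φ : L2Time S H) (v : L2Time S V)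
    (hv : ∀ᵐ t ∂(timeMeasure S), j.adjoint (j (v t)) + ∫ s in Ioc 0 t, v s
      = j.adjoint (∫ s in Ioc 0 t, (φ - C v : L2Time S H) s)) :
    v = continuousToL2Time hS V (perturbedFlow hS j C φ) := by
  have h1 := eq_parabolicFlow_of_integrated hS hj hj' (φ - C v) v hv
  have h2 : (1 + perturbOp hS j C) (φ - C v) = φ := by
    change (φ - C v) + C (continuousToL2Time hS V (parabolicFlow hS j (φ - C v))) = φ
    rw [← h1, sub_add_cancel]
  have h3 : perturbInverse hS j C φ = φ - C v := by
    conv_lhs => rw [← h2]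
    exact congrArg (fun L : L2Time S H →L[ℝ] L2Time S H => L (φ - C v))
      (Ring.inverse_mul_cancel _ (isUnit_one_add_perturbOp hS hj' hC))
  rw [perturbedFlow, ContinuousLinearMap.comp_apply, h3]
  exact h1

/-! ### The homogeneous flow and the backward problem -/

/-- The homogeneous flow `j† η ↦ e^{-tΛ} j† η` on the range of `j†`. -/
def homogeneousFlowOnRange (j : V →L[ℝ] H) : H →ₗ[ℝ] C(Icc (0 : ℝ) S, V) where
  -- The constant j†η is a stationary solution with source η; subtracting the flow that starts at 0
  -- with the same source leaves the homogeneous solution starting at j†η.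
  toFun η := ContinuousMap.const _ (j.adjoint η)
    - parabolicFlow hS j (continuousToL2Time hS H (ContinuousMap.const _ η))
  map_add' η η' := by
    have h : (ContinuousMap.const (Icc (0 : ℝ) S) (η + η'))
      = ContinuousMap.const _ η + ContinuousMap.const _ η' := rfl
    rw [h, map_add, map_add, map_add, sub_add_sub_comm]
    rfl
  map_smul' a η := by
    have h : (ContinuousMap.const (Icc (0 : ℝ) S) (a • η))
      = a • ContinuousMap.const _ η := rfl
    rw [h, map_smul, map_smul, map_smul, RingHom.id_apply, smul_sub]
    rfl

lemma partialInner_const_right {t : ℝ} (ht : t ≤ S) (f : L2Time S H) (η : H) :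
    partialInner t f (continuousToL2Time hS H (ContinuousMap.const _ η))
      = inner ℝ (∫ s in Ioc 0 t, f s) η := by
  rw [real_inner_comm, ← integral_inner (L2Time_integrableOn_Ioc f ht)]
  refine integral_congr_ae ?_
  filter_upwards [ae_Ioc_of_ae_timeMeasure ht
    (coeFn_continuousToL2Time hS (ContinuousMap.const _ η))] with s hs
  rw [hs, real_inner_comm]
  rfl

/-- Expanding the square, ‖j†η - v(t)‖² equals ‖j†η‖² - 2∫|∂ₜv|² over (0,t): the flow contracts V,
hence extends from the dense range of j†. -/
lemma norm_homogeneousFlowOnRange_le (hj : Function.Injective j.adjoint) (η : H) :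
    ‖homogeneousFlowOnRange hS j η‖ ≤ 1 * ‖j.adjoint η‖ := by
  refine (ContinuousMap.norm_le _ (by positivity)).2 fun t => ?_
  rw [one_mul]
  refine le_of_sq_le_sq ?_ (norm_nonneg _)
  set g := continuousToL2Time hS H (ContinuousMap.const _ η) with hg
  change ‖j.adjoint η - parabolicFlow hS j g t‖ ^ 2 ≤ _
  have h1 : inner ℝ (j.adjoint η) (parabolicFlow hS j g t)
      = partialInner t (g - ellipticPart hS j g) g := by
    rw [ContinuousLinearMap.adjoint_inner_left, map_parabolicFlow hS hj,
      partialInner_const_right hS t.2.2, real_inner_comm]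
    rfl
  have h2 := partialInner_self_nonneg (t : ℝ) (g - ellipticPart hS j g)
  rw [partialInner_sub_right t.2.2] at h2
  rw [norm_sub_sq_real, h1, sq_norm_parabolicFlow hS hj]
  linarith

/-- The homogeneous flow `ζ ↦ e^{-tΛ} ζ`, from `V` to `C([0, S]; V)`. -/
def homogeneousFlow (j : V →L[ℝ] H) : V →L[ℝ] C(Icc (0 : ℝ) S, V) :=
  (homogeneousFlowOnRange hS j).extendOfNorm j.adjoint.toLinearMap

lemma denseRange_adjoint (hj : Function.Injective j) : DenseRange j.adjoint :=
  denseRange_of_adjoint_injective (by rwa [ContinuousLinearMap.adjoint_adjoint])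

lemma homogeneousFlow_adjoint (hj : Function.Injective j) (hj' : Function.Injective j.adjoint)
    (η : H) : homogeneousFlow hS j (j.adjoint η) = ContinuousMap.const _ (j.adjoint η)
      - parabolicFlow hS j (continuousToL2Time hS H (ContinuousMap.const _ η)) :=
  LinearMap.extendOfNorm_eq (denseRange_adjoint hj)
    ⟨1, norm_homogeneousFlowOnRange_le hS hj'⟩ η

lemma homogeneousFlow_zero (hj : Function.Injective j) (hj' : Function.Injective j.adjoint)
    (ζ : V) : homogeneousFlow hS j ζ ⟨0, le_rfl, hS⟩ = ζ := by
  refine (denseRange_adjoint hj).induction_on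
    (p := fun ζ => homogeneousFlow hS j ζ ⟨0, le_rfl, hS⟩ = ζ) ζ
    (isClosed_eq (by fun_prop) (by fun_prop)) fun η => ?_
  rw [homogeneousFlow_adjoint hS hj hj', ContinuousMap.sub_apply, parabolicFlow_zero hS hj',
    sub_zero]
  rfl

/-- The value at the final time of a continuous function on `[0, S]`. -/
def evalFinal (E : Type) [NormedAddCommGroup E] [InnerProductSpace ℝ E] :
    C(Icc (0 : ℝ) S, E) →L[ℝ] E :=
  ContinuousMap.evalCLM ℝ ⟨S, hS, le_rfl⟩

omit [CompleteSpace H] in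
lemma timeReverse_const (η : H) :
    timeReverse S H (continuousToL2Time hS H (ContinuousMap.const _ η))
      = continuousToL2Time hS H (ContinuousMap.const _ η) := by
  refine Lp.ext ?_
  filter_upwards [coeFn_timeReverse (continuousToL2Time hS H (ContinuousMap.const _ η)),
    coeFn_continuousToL2Time hS (ContinuousMap.const _ η),
    (measurePreserving_reflect S).quasiMeasurePreserving.ae
      (coeFn_continuousToL2Time hS (ContinuousMap.const _ η))] with s h1 h2 h3
  rw [h1, h2, h3]
  rfl

omit [CompleteSpace V] [CompleteSpace H] in
lemma timeMap_const (L : H →L[ℝ] V) (η : H) :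
    timeMap S L (continuousToL2Time hS H (ContinuousMap.const _ η))
      = continuousToL2Time hS V (ContinuousMap.const _ (L η)) := by
  refine Lp.ext ?_
  filter_upwards [coeFn_timeMap L (continuousToL2Time hS H (ContinuousMap.const _ η)),
    coeFn_continuousToL2Time hS (ContinuousMap.const _ η),
    coeFn_continuousToL2Time hS (ContinuousMap.const _ (L η))] with s h1 h2 h3
  rw [h1, h2, h3]
  rfl

/-- The adjoint of `g ↦ v(S)` is the backward homogeneous flow. -/
lemma timeMap_adjoint_evalFinal (hj : Function.Injective j) (hj' : Function.Injective j.adjoint)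
    (ζ : V) :
    timeMap S j.adjoint ((evalFinal hS V ∘L parabolicFlow hS j).adjoint ζ)
      = timeReverse S V (continuousToL2Time hS V (homogeneousFlow hS j ζ)) := by
  refine (denseRange_adjoint hj).induction_on
    (p := fun ζ => timeMap S j.adjoint ((evalFinal hS V ∘L parabolicFlow hS j).adjoint ζ)
      = timeReverse S V (continuousToL2Time hS V (homogeneousFlow hS j ζ))) ζ
    (isClosed_eq (by fun_prop) (by fun_prop)) fun η => ?_
  set e := continuousToL2Time hS H (ContinuousMap.const _ η) with he
  -- For data j†η the pairing (v(S), j†η)_V is (jv(S), η)_H, and jv(S) = ∫(g - Λv), so the adjoint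
  -- is explicit.
  have h1 : (evalFinal hS V ∘L parabolicFlow hS j).adjoint (j.adjoint η)
      = e - (ellipticPart hS j).adjoint e := by
    refine ext_inner_left ℝ fun g => ?_
    rw [ContinuousLinearMap.adjoint_inner_right, ContinuousLinearMap.adjoint_inner_right,
      inner_sub_right, ContinuousLinearMap.adjoint_inner_right, ← inner_sub_left, he,
      inner_continuousToL2Time_const, ← map_parabolicFlow hS hj']
    rfl
  rw [h1, map_sub, adjoint_ellipticPart hS hj', he, timeReverse_const, ← timeReverse_timeMap,
    ← continuousToL2Time_parabolicFlow hS hj', homogeneousFlow_adjoint hS hj hj', map_sub, map_sub,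
    timeMap_const, ← timeMap_const, timeReverse_timeMap, timeReverse_const]

/-- The solution by transposition of `-∂ₜ p + Λ p + C* p = 0`, `p(S) = ζ`. -/
def transpositionSolution (j : V →L[ℝ] H) (C : L2Time S V →L[ℝ] L2Time S H) (ζ : V) :
    L2Time S H :=
  (evalFinal hS V ∘L perturbedFlow hS j C).adjoint ζ

lemma inner_transpositionSolution (ζ : V) (φ : L2Time S H) :
    inner ℝ (transpositionSolution hS j C ζ) φ
      = inner ℝ ζ (perturbedFlow hS j C φ ⟨S, hS, le_rfl⟩) := by
  rw [transpositionSolution, ContinuousLinearMap.adjoint_inner_left]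
  rfl

lemma exists_continuous_adjoint_transpositionSolution (hj : Function.Injective j)
    (hj' : Function.Injective j.adjoint)
    (hC : ∀ v, ∀ᵐ s ∂(timeMeasure S), ‖C v s‖ ≤ c * ‖v s‖) (ζ : V) :
    ∃ a : C(Icc (0 : ℝ) S, V), a ⟨0, le_rfl, hS⟩ = ζ ∧
      timeMap S j.adjoint (transpositionSolution hS j C ζ)
        = timeReverse S V (continuousToL2Time hS V a) := by
  set p := transpositionSolution hS j C ζ with hp
  set q := C.adjoint p with hq
  -- Duhamel's formula in reversed time, with the term C†p treated as a known source q.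
  refine ⟨homogeneousFlow hS j ζ - parabolicFlow hS j (timeReverse S H (timeMap S j q)), ?_, ?_⟩
  · rw [ContinuousMap.sub_apply, homogeneousFlow_zero hS hj hj', parabolicFlow_zero hS hj',
      sub_zero]
  -- Testing p against φ = g + Cv, whose state is the unperturbed flow v of g, gives (p, g) + (q, v)
  -- = (ζ, v(S)). As v = j†Λv, the middle term is (jq, Λv).
  have h1 : p = (evalFinal hS V ∘L parabolicFlow hS j).adjoint ζ
      - (ellipticPart hS j).adjoint (timeMap S j q) := by
    refine ext_inner_left ℝ fun g => ?_
    rw [inner_sub_right, ContinuousLinearMap.adjoint_inner_right,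
      ContinuousLinearMap.adjoint_inner_right, ← ContinuousLinearMap.adjoint_adjoint (timeMap S j),
      adjoint_timeMap, ContinuousLinearMap.adjoint_inner_right,
      ← continuousToL2Time_parabolicFlow hS hj', hq, ContinuousLinearMap.adjoint_inner_right]
    have h2 := congrArg (fun L : L2Time S H →L[ℝ] L2Time S H => L g)
      (Ring.inverse_mul_cancel _ (isUnit_one_add_perturbOp hS hj' hC))
    have h3 : perturbInverse hS j C (g + perturbOp hS j C g) = g := h2
    have h4 : inner ℝ (g + perturbOp hS j C g) p
        = inner ℝ ((evalFinal hS V ∘L parabolicFlow hS j) g) ζ := by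
      rw [hp, transpositionSolution, ContinuousLinearMap.adjoint_inner_right]
      change inner ℝ (evalFinal hS V (parabolicFlow hS j (perturbInverse hS j C
        (g + perturbOp hS j C g)))) ζ = _
      rw [h3]
      rfl
    rw [← h4, inner_add_left]
    exact (add_sub_cancel_right _ _).symm
  rw [h1, map_sub, timeMap_adjoint_evalFinal hS hj hj', adjoint_ellipticPart hS hj',
    ← timeReverse_timeMap, ← continuousToL2Time_parabolicFlow hS hj', map_sub, map_sub]

end ParabolicFlow

/-! ### Weak and strong measurability in separable Hilbert spaces -/

section WeakMeasurability

variable {H : Type} [NormedAddCommGroup H] [InnerProductSpace ℝ H]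

/-- Orthonormal vectors lie √2 apart, so balls of radius 1/2 around them are disjoint open sets. -/
lemma Orthonormal.countable_of_separable [SecondCountableTopology H] {ι : Type} {b : ι → H}
    (hb : Orthonormal ℝ b) : Countable ι := by
  have h : (univ : Set ι).PairwiseDisjoint fun i => Metric.ball (b i) (1 / 2) := by
    intro i _ k _ hik
    refine Metric.ball_disjoint_ball ?_
    have h1 : ‖b i - b k‖ ^ 2 = 2 := by
      rw [norm_sub_sq_real, hb.1, hb.1, hb.2 hik]; norm_num
    rw [dist_eq_norm]
    nlinarith [norm_nonneg (b i - b k)]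
  exact countable_univ_iff.1 (h.countable_of_isOpen (fun _ _ => Metric.isOpen_ball)
    fun i _ => ⟨b i, Metric.mem_ball_self (by norm_num)⟩)

/-- Pettis: a weakly measurable function with values in a separable Hilbert space is strongly
measurable. -/
lemma stronglyMeasurable_of_inner [CompleteSpace H] [SecondCountableTopology H] {Ω : Type}
    [MeasurableSpace Ω] {f : Ω → H} (hf : ∀ c, Measurable fun s => (inner ℝ c (f s) : ℝ)) :
    StronglyMeasurable f := by
  obtain ⟨w, b, -⟩ := exists_hilbertBasis ℝ H
  have : Countable w := b.orthonormal.countable_of_separable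
  refine stronglyMeasurable_of_tendsto (u := (Filter.atTop : Filter (Finset w)))
    (f := fun F s => ∑ i ∈ F, (inner ℝ (b i) (f s) : ℝ) • b i) (fun F => ?_)
    (tendsto_pi_nhds.2 fun s => ?_)
  · refine Finset.stronglyMeasurable_fun_sum F fun i _ => ?_
    exact (hf (b i)).stronglyMeasurable.smul_const (b i)
  · have h := b.hasSum_repr (f s)
    simp_rw [b.repr_apply_apply] at h
    exact h

end WeakMeasurability

/-! ### Scalar distributional derivatives on an interval -/

section DuBoisReymond

lemma exists_Icc_of_isCompact_subset_Ioo {K : Set ℝ} (hK : IsCompact K) {S : ℝ} (hS : 0 < S)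
    (h : K ⊆ Ioo 0 S) : ∃ a b, 0 < a ∧ b < S ∧ K ⊆ Icc a b := by
  rcases K.eq_empty_or_nonempty with rfl | hne
  -- For empty K the endpoints may be reversed; the resulting interval is empty.
  · exact ⟨S, 0, hS, hS, empty_subset _⟩
  · obtain ⟨a, ha⟩ := hK.exists_isLeast hne
    obtain ⟨b, hb⟩ := hK.exists_isGreatest hne
    exact ⟨a, b, (h ha.1).1, (h hb.1).2, fun x hx => ⟨ha.2 hx, hb.2 hx⟩⟩

/-- The primitive from 0 vanishes to the left of the support of η, and the zero mean makes it vanish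
to the right. -/
lemma exists_compactSupport_primitive {S : ℝ} (hS : 0 < S) {η : ℝ → ℝ} (hη : ContDiff ℝ ∞ η)
    (hc : HasCompactSupport η) (hs : tsupport η ⊆ Ioo 0 S) (h0 : ∫ s in Ioo 0 S, η s = 0) :
    ∃ θ : ℝ → ℝ, ContDiff ℝ ∞ θ ∧ HasCompactSupport θ ∧ tsupport θ ⊆ Ioo 0 S ∧ deriv θ = η := by
  obtain ⟨a, b, ha, hb, hab⟩ := exists_Icc_of_isCompact_subset_Ioo hc hS hs
  have hz : ∀ x, x ∉ Icc a b → η x = 0 := fun x hx =>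
    image_eq_zero_of_notMem_tsupport fun h => hx (hab h)
  have hd : ∀ x, HasDerivAt (fun t => ∫ s in (0 : ℝ)..t, η s) (η x) x := fun x =>
    intervalIntegral.integral_hasDerivAt_right (hη.continuous.intervalIntegrable _ _)
      (hη.continuous.stronglyMeasurableAtFilter _ _) hη.continuous.continuousAt
  have hd' : deriv (fun t => ∫ s in (0 : ℝ)..t, η s) = η := funext fun x => (hd x).deriv
  have h0' : ∫ s in (0 : ℝ)..S, η s = 0 := by
    rw [intervalIntegral.integral_of_le hS.le, integral_Ioc_eq_integral_Ioo, h0]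
  have hsub : tsupport (fun t => ∫ s in (0 : ℝ)..t, η s) ⊆ Icc a b := by
    refine closure_minimal (fun t ht => ?_) isClosed_Icc
    by_contra hn
    refine ht ?_
    rcases lt_or_ge t a with h | h
    · refine intervalIntegral.integral_zero_ae (Filter.Eventually.of_forall fun s hs => hz s ?_)
      intro hs'
      rcases mem_uIoc.1 hs with h1 | h1
      · linarith [hs'.1, h1.2]
      · linarith [hs'.1, h1.2]
    · have hbt : b < t := by
        by_contra hbt
        exact hn ⟨h, not_lt.1 hbt⟩
      have h1 : ∫ s in t..S, η s = 0 := by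
        refine intervalIntegral.integral_zero_ae (Filter.Eventually.of_forall fun s hs => hz s ?_)
        intro hs'
        rcases mem_uIoc.1 hs with h1 | h1
        · linarith [hs'.2, h1.1]
        · linarith [hs'.2, h1.1]
      have h2 := intervalIntegral.integral_add_adjacent_intervals
        (hη.continuous.intervalIntegrable 0 t) (hη.continuous.intervalIntegrable (μ := volume) t S)
      rw [h1, h0', add_zero] at h2
      exact h2
  refine ⟨_, ?_, ?_, hsub.trans fun x hx => ⟨ha.trans_le hx.1, hx.2.trans_lt hb⟩, hd'⟩
  · rw [contDiff_infty_iff_deriv, hd']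
    exact ⟨fun x => (hd x).differentiableAt, hη⟩
  · exact isCompact_Icc.of_isClosed_subset (isClosed_tsupport _) hsub

/-- For a fixed bump ρ of mass one, ψ - (∫ψ)ρ has mean zero and so is an admissible derivative.
Hence c - ∫ρc is orthogonal to every test function ψ; continuity upgrades equality a.e. to all of
[0, S]. -/
lemma eqOn_const_of_integral_deriv_mul_eq_zero {S : ℝ} (hS : 0 < S) {c : ℝ → ℝ}
    (hc : ContinuousOn c (Icc 0 S))
    (h : ∀ θ : ℝ → ℝ, ContDiff ℝ ∞ θ → HasCompactSupport θ → tsupport θ ⊆ Ioo 0 S →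
      ∫ s in Ioo 0 S, deriv θ s * c s = 0) : ∃ k, EqOn c (fun _ => k) (Icc 0 S) := by
  let B : ContDiffBump (S / 2 : ℝ) := ⟨S / 8, S / 4, by positivity, by linarith⟩
  set ρ : ℝ → ℝ := B.normed volume with hρ
  have hρ1 : ContDiff ℝ ∞ ρ := B.contDiff_normed
  have hρ2 : HasCompactSupport ρ := B.hasCompactSupport_normed
  have hρ3 : tsupport ρ ⊆ Ioo 0 S := by
    rw [hρ, B.tsupport_normed_eq, Real.closedBall_eq_Icc]
    intro x hx
    change x ∈ Icc (S / 2 - S / 4) (S / 2 + S / 4) at hx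
    exact ⟨by linarith [hx.1], by linarith [hx.2]⟩
  have setInt : ∀ {f : ℝ → ℝ}, tsupport f ⊆ Ioo 0 S → ∫ s in Ioo 0 S, f s = ∫ s, f s :=
    fun hf => setIntegral_eq_integral_of_forall_compl_eq_zero fun x hx =>
      image_eq_zero_of_notMem_tsupport fun h => hx (hf h)
  have hρ4 : ∫ s in Ioo 0 S, ρ s = 1 := by rw [setInt hρ3]; exact B.integral_normed
  have hci : IntegrableOn c (Ioo 0 S) :=
    (hc.integrableOn_Icc).mono_set Ioo_subset_Icc_self
  have hmul : ∀ {f : ℝ → ℝ}, Continuous f → HasCompactSupport f →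
      IntegrableOn (fun s => f s * c s) (Ioo 0 S) := fun {f} hf hfc => by
    obtain ⟨M, hM⟩ := hf.bounded_above_of_compact_support hfc
    exact Integrable.bdd_mul hci hf.aestronglyMeasurable (Filter.Eventually.of_forall hM)
  set k : ℝ := ∫ s in Ioo 0 S, ρ s * c s with hk
  refine ⟨k, ?_⟩
  have hae : ∀ᵐ x ∂(volume : Measure ℝ), x ∈ Ioo 0 S → c x - k = 0 := by
    refine IsOpen.ae_eq_zero_of_integral_contDiff_smul_eq_zero isOpen_Ioo ?_ ?_
    · exact (hci.sub (integrableOn_const measure_Ioo_lt_top.ne)).locallyIntegrableOn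
    intro ψ hψ hψc hψs
    have hψi : IntegrableOn ψ (Ioo 0 S) :=
      (hψ.continuous.integrable_of_hasCompactSupport hψc).integrableOn
    have hρi : IntegrableOn ρ (Ioo 0 S) :=
      (hρ1.continuous.integrable_of_hasCompactSupport hρ2).integrableOn
    set m : ℝ := ∫ s in Ioo 0 S, ψ s with hm
    have hts : tsupport (fun s => ψ s - m * ρ s) ⊆ Ioo 0 S := by
      refine (tsupport_sub ψ (fun s => m * ρ s)).trans (union_subset hψs ?_)
      exact (tsupport_mul_subset_right (f := fun _ => m) (g := ρ)).trans hρ3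
    obtain ⟨θ, h1, h2, h3, h4⟩ := exists_compactSupport_primitive hS
      (η := fun s => ψ s - m * ρ s) (hψ.sub (contDiff_const.mul hρ1))
      (hψc.sub (hρ2.mul_left (f := fun _ => m))) hts (by
        rw [integral_sub hψi (hρi.const_mul m), integral_const_mul, hρ4, mul_one, sub_self])
    have h5 := h θ h1 h2 h3
    rw [h4] at h5
    have h6 : ∀ s, (ψ s - m * ρ s) * c s = ψ s * c s - m * (ρ s * c s) := fun s => by ring
    simp_rw [h6] at h5
    rw [integral_sub (hmul hψ.continuous hψc) ((hmul hρ1.continuous hρ2).const_mul m),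
      integral_const_mul, ← hk] at h5
    have h7 : ∫ x, ψ x • (c x - k) = ∫ x in Ioo 0 S, ψ x * c x - k * ψ x := by
      rw [← setInt (f := fun x => ψ x • (c x - k))
        ((tsupport_mul_subset_left (f := ψ) (g := fun x => c x - k)).trans hψs)]
      refine integral_congr_ae (Filter.Eventually.of_forall fun x => ?_)
      simp only [smul_eq_mul]; ring
    rw [h7, integral_sub (hmul hψ.continuous hψc) (hψi.const_mul k), integral_const_mul, ← hm]
    linarith
  refine Measure.eqOn_Icc_of_ae_eq volume hS.ne ?_ hc continuousOn_const
  rw [← Measure.restrict_congr_set Ioo_ae_eq_Icc]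
  filter_upwards [(ae_restrict_iff' measurableSet_Ioo).2 hae] with x hx
  linarith

/-- Integration by parts for primitives, with θ vanishing at both endpoints. -/
lemma integral_deriv_mul_primitive {S : ℝ} {w θ : ℝ → ℝ} (hS : 0 ≤ S)
    (hw : IntegrableOn w (Ioo 0 S)) (hθ : ContDiff ℝ ∞ θ) (hθs : tsupport θ ⊆ Ioo 0 S) :
    ∫ s in Ioo 0 S, deriv θ s * ∫ r in Ioc 0 s, w r = -∫ s in Ioo 0 S, θ s * w s := by
  have hc : Continuous (deriv θ) := hθ.continuous_deriv (by simp)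
  have h0 : θ 0 = 0 := image_eq_zero_of_notMem_tsupport fun h => lt_irrefl _ (hθs h).1
  have h1 : θ S = 0 := image_eq_zero_of_notMem_tsupport fun h => lt_irrefl _ (hθs h).2
  have h2 : ∀ t, 0 ≤ t → ∫ r in Ioc 0 t, deriv θ r = θ t := fun t ht => by
    rw [← intervalIntegral.integral_of_le ht, intervalIntegral.integral_deriv_eq_sub'
      θ rfl (fun x _ => (hθ.differentiable (by simp)).differentiableAt) hc.continuousOn, h0,
      sub_zero]
  have h3 := integral_inner_primitive_add (f := deriv θ) (g := w) (t := S) hc.integrableOn_Ioc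
    (by rwa [integrableOn_Ioc_iff_integrableOn_Ioo])
  rw [h2 S hS, h1, inner_zero_left] at h3
  have h4 : ∫ s in Ioc 0 S, inner ℝ (∫ r in Ioc 0 s, deriv θ r) (w s)
      = ∫ s in Ioc 0 S, θ s * w s := by
    refine setIntegral_congr_fun measurableSet_Ioc fun s hs => ?_
    simp only [h2 s hs.1.le]
    rw [real_inner_comm]; rfl
  rw [h4] at h3
  rw [← integral_Ioc_eq_integral_Ioo, ← integral_Ioc_eq_integral_Ioo, ← eq_neg_of_add_eq_zero_left h3]
  refine integral_congr_ae (Filter.Eventually.of_forall fun s => ?_)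
  simp only
  rw [real_inner_comm]; rfl

/-- A continuous function with integrable distributional derivative is a primitive of it. -/
lemma eq_primitive_of_weakDeriv {S : ℝ} (hS : 0 < S) {u w : ℝ → ℝ} (hu : ContinuousOn u (Icc 0 S))
    (hw : IntegrableOn w (Ioo 0 S)) (h0 : u 0 = 0)
    (h : ∀ θ : ℝ → ℝ, ContDiff ℝ ∞ θ → HasCompactSupport θ → tsupport θ ⊆ Ioo 0 S →
      ∫ s in Ioo 0 S, deriv θ s * u s = -∫ s in Ioo 0 S, θ s * w s) {t : ℝ} (ht : t ∈ Icc 0 S) :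
    u t = ∫ s in Ioc 0 t, w s := by
  have hW : ContinuousOn (fun t => ∫ s in Ioc 0 t, w s) (Icc 0 S) :=
    intervalIntegral.continuousOn_primitive (by
      rwa [integrableOn_Icc_iff_integrableOn_Ioo])
  obtain ⟨k, hk⟩ := eqOn_const_of_integral_deriv_mul_eq_zero hS (hu.sub hW) fun θ h1 h2 h3 => by
    have hc : Continuous (deriv θ) := h1.continuous_deriv (by simp)
    have hmul : ∀ {f : ℝ → ℝ}, ContinuousOn f (Icc 0 S) →
        IntegrableOn (fun s => deriv θ s * f s) (Ioo 0 S) := fun hf =>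
      ((hc.continuousOn.mul hf).integrableOn_Icc).mono_set Ioo_subset_Icc_self
    simp_rw [Pi.sub_apply, mul_sub]
    rw [integral_sub (hmul hu) (hmul hW), h θ h1 h2 h3,
      integral_deriv_mul_primitive hS.le hw h1 h3, sub_self]
  have e0 := hk (left_mem_Icc.2 hS.le)
  have e1 := hk ht
  simp only [Pi.sub_apply, h0, Ioc_self, setIntegral_empty, sub_zero] at e0 e1
  rw [← e0] at e1
  exact sub_eq_zero.1 e1

end DuBoisReymond

/-! ### H¹(K) as a Hilbert space embedded injectively and densely in L²(K) -/

section WeightedSpaces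

variable {N : ℕ}

instance (N : ℕ) : IsLocallyFiniteMeasure (weightMeasure N) := by
  refine IsLocallyFiniteMeasure.withDensity_ofReal ?_
  unfold gaussWeight
  fun_prop

instance (N : ℕ) : SFinite (weightMeasure N) := by
  unfold weightMeasure; infer_instance

lemma ae_weight_of_volume {P : EuclideanSpace ℝ (Fin N) → Prop} (h : ∀ᵐ y, P y) :
    ∀ᵐ y ∂(weightMeasure N), P y :=
  (withDensity_absolutelyContinuous _ _).ae_le h

/-- The functional `f ↦ ∫ f η dy` on `L²(K)`, for a test function `η`. -/
def testFunctional {η : EuclideanSpace ℝ (Fin N) → ℝ} (hη : Continuous η)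
    (hc : HasCompactSupport η) : L2K N →L[ℝ] ℝ :=
  LinearMap.mkContinuous
    { toFun := fun f => ∫ y, f y * η y
      map_add' := fun f g => integral_L2K_add f g hη hc
      map_smul' := fun c f => integral_L2K_smul c f η }
    ‖(hη.memLp_of_hasCompactSupport hc (p := 2) (μ := volume)).toLp η‖
    (by
      intro f
      have h1 : MemLp f 2 (volume : Measure (EuclideanSpace ℝ (Fin N))) :=
        (Lp.memLp f).mono_measure (volume_le_weightMeasure N)
      have h2 : MemLp η 2 (volume : Measure (EuclideanSpace ℝ (Fin N))) :=
        hη.memLp_of_hasCompactSupport hc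
      have h3 : ‖h1.toLp f‖ ≤ ‖f‖ := by
        rw [Lp.norm_toLp, Lp.norm_def]
        exact ENNReal.toReal_mono (Lp.eLpNorm_ne_top f)
          (eLpNorm_mono_measure _ (volume_le_weightMeasure N))
      have h4 : ∫ y, f y * η y = inner ℝ (h2.toLp η) (h1.toLp f) := by
        rw [L2.inner_def]
        refine integral_congr_ae ?_
        filter_upwards [h1.coeFn_toLp, h2.coeFn_toLp] with y e1 e2
        rw [e1, e2]
        rfl
      change ‖∫ y, f y * η y‖ ≤ _
      rw [h4]
      exact (norm_inner_le_norm _ _).trans (by gcongr))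

/-- Each weak derivative condition equates two continuous functionals of the pair. Closedness gives
completeness, needed for Riesz representation and adjoints. -/
lemma isClosed_H1KGraph (N : ℕ) :
    IsClosed (H1KGraph N : Set (WithLp 2 (L2K N × PiLp 2 (fun _ : Fin N => L2K N)))) := by
  have h : (H1KGraph N : Set (WithLp 2 (L2K N × PiLp 2 (fun _ : Fin N => L2K N))))
      = ⋂ (i : Fin N) (η : EuclideanSpace ℝ (Fin N) → ℝ) (hη : ContDiff ℝ ∞ η)
        (hc : HasCompactSupport η),
        {u | testFunctional (continuous_partial hη (EuclideanSpace.single i 1))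
          (hasCompactSupport_partial hc _) u.fst = -testFunctional hη.continuous hc (u.snd i)} := by
    ext u
    simp only [mem_iInter]
    rfl
  rw [h]
  refine isClosed_iInter fun i => isClosed_iInter fun η => isClosed_iInter fun hη =>
    isClosed_iInter fun hc => isClosed_eq ?_ ?_
  · exact (ContinuousLinearMap.continuous _).comp
      (WithLp.fstL 2 ℝ (L2K N) (PiLp 2 (fun _ : Fin N => L2K N))).continuous
  · exact ((ContinuousLinearMap.continuous _).comp
      ((PiLp.proj 2 (𝕜 := ℝ) (fun _ : Fin N => L2K N) i).continuous.comp
      (WithLp.sndL 2 ℝ (L2K N) (PiLp 2 (fun _ : Fin N => L2K N))).continuous)).neg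

instance (N : ℕ) : CompleteSpace (H1K N) := (isClosed_H1KGraph N).completeSpace_coe

/-- The bounded operator `u ↦ ∂u/∂yᵢ` from `H¹(K)` to `L²(K)`. -/
def partialCLM (i : Fin N) : H1K N →L[ℝ] L2K N :=
  (PiLp.proj 2 (𝕜 := ℝ) (fun _ : Fin N => L2K N) i ∘L
    WithLp.sndL 2 ℝ (L2K N) (PiLp 2 (fun _ : Fin N => L2K N))) ∘L (H1KGraph N).subtypeL

lemma isWeakPartial_partial (u : H1K N) (i : Fin N) : IsWeakPartial i u.toL2 (u.partial i) := u.2 i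

/-- Points of H¹(K) are pairs (f, ∇f), so injectivity is uniqueness of the weak gradient. -/
lemma toL2_injective (N : ℕ) : Function.Injective (H1K.toL2 (N := N)) := by
  refine (injective_iff_map_eq_zero _).2 fun u hu => ?_
  have h : ∀ i, u.partial i = 0 := by
    intro i
    have h0 : ∀ᵐ y ∂(volume : Measure (EuclideanSpace ℝ (Fin N))), u.partial i y = 0 := by
      refine ae_eq_zero_of_integral_contDiff_smul_eq_zero ?_ fun η hη hc => ?_
      · exact (((Lp.memLp (u.partial i)).mono_measure
          (volume_le_weightMeasure N)).locallyIntegrable (by norm_num))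
      · have h1 := isWeakPartial_partial u i η hη hc
        have h2 : ∫ y, u.toL2 y * fderiv ℝ η y (EuclideanSpace.single i 1) = 0 := by
          rw [hu]
          exact map_zero (testFunctional (continuous_partial hη (EuclideanSpace.single i 1))
            (hasCompactSupport_partial hc _))
        rw [h2] at h1
        simp_rw [smul_eq_mul, mul_comm (η _)]
        linarith
    refine Lp.ext ?_
    filter_upwards [ae_weight_of_volume h0, Lp.coeFn_zero ℝ 2 (weightMeasure N)] with y h1 h2
    rw [h1, h2, Pi.zero_apply]
  refine Subtype.ext ((WithLp.ofLp_injective 2) (Prod.ext hu ?_))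
  refine (WithLp.ofLp_injective 2) (funext fun i => h i)

/-- A test function as an element of `L²(K)`. -/
def testL2 {η : EuclideanSpace ℝ (Fin N) → ℝ} (hη : Continuous η) (hc : HasCompactSupport η) :
    L2K N :=
  (hη.memLp_of_hasCompactSupport hc).toLp η

lemma coeFn_testL2 {η : EuclideanSpace ℝ (Fin N) → ℝ} (hη : Continuous η)
    (hc : HasCompactSupport η) : testL2 hη hc =ᵐ[weightMeasure N] η :=
  MemLp.coeFn_toLp _

lemma isWeakPartial_testL2 {η : EuclideanSpace ℝ (Fin N) → ℝ} (hη : ContDiff ℝ ∞ η)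
    (hc : HasCompactSupport η) (i : Fin N) :
    IsWeakPartial i (testL2 hη.continuous hc)
      (testL2 (continuous_partial hη (EuclideanSpace.single i 1))
        (hasCompactSupport_partial hc _)) := by
  intro ζ hζ hζc
  have e1 := ae_volume_of_weight (coeFn_testL2 hη.continuous hc)
  have e2 := ae_volume_of_weight (coeFn_testL2 (continuous_partial hη (EuclideanSpace.single i 1))
    (hasCompactSupport_partial hc _))
  have h1 : ∫ y, testL2 hη.continuous hc y * fderiv ℝ ζ y (EuclideanSpace.single i 1)
      = ∫ y, η y * fderiv ℝ ζ y (EuclideanSpace.single i 1) := by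
    refine integral_congr_ae ?_
    filter_upwards [e1] with y hy
    rw [hy]
  have h2 : ∫ y, testL2 (continuous_partial hη (EuclideanSpace.single i 1))
        (hasCompactSupport_partial hc _) y * ζ y
      = ∫ y, fderiv ℝ η y (EuclideanSpace.single i 1) * ζ y := by
    refine integral_congr_ae ?_
    filter_upwards [e2] with y hy
    rw [hy]
  rw [h1, h2]
  refine integral_mul_fderiv_eq_neg_fderiv_mul_of_integrable ?_ ?_ ?_
    (fun x _ => (hη.differentiable (by simp)).differentiableAt)
    (fun x _ => (hζ.differentiable (by simp)).differentiableAt)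
  · exact ((continuous_partial hη _).mul hζ.continuous).integrable_of_hasCompactSupport
      hζc.mul_left
  · exact (hη.continuous.mul (continuous_partial hζ _)).integrable_of_hasCompactSupport
      hc.mul_right
  · exact (hη.continuous.mul hζ.continuous).integrable_of_hasCompactSupport hc.mul_right

/-- A test function as an element of `H¹(K)`. -/
def testH1 {η : EuclideanSpace ℝ (Fin N) → ℝ} (hη : ContDiff ℝ ∞ η) (hc : HasCompactSupport η) :
    H1K N :=
  ⟨WithLp.toLp 2 (testL2 hη.continuous hc, WithLp.toLp 2 fun i =>
      testL2 (continuous_partial hη (EuclideanSpace.single i 1)) (hasCompactSupport_partial hc _)),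
    fun i => isWeakPartial_testL2 hη hc i⟩

/-- Density of H¹(K): it contains the test functions, and the fundamental lemma applies directly to
the locally finite measure K dy. -/
lemma eq_zero_of_inner_toL2 {f : L2K N} (hf : ∀ z : H1K N, inner ℝ f z.toL2 = 0) : f = 0 := by
  have h0 : ∀ᵐ y ∂(weightMeasure N), f y = 0 := by
    refine ae_eq_zero_of_integral_contDiff_smul_eq_zero ?_ fun η hη hc => ?_
    · exact (Lp.memLp f).locallyIntegrable (by norm_num)
    · have h1 := hf (testH1 hη hc)
      rw [L2.inner_def] at h1
      rw [← h1]
      refine integral_congr_ae ?_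
      filter_upwards [coeFn_testL2 hη.continuous hc] with y hy
      change η y • f y = inner ℝ (f y) (testL2 hη.continuous hc y)
      rw [hy]
      rfl
  refine Lp.ext ?_
  filter_upwards [h0, Lp.coeFn_zero ℝ 2 (weightMeasure N)] with y h1 h2
  rw [h1, h2, Pi.zero_apply]

lemma inner_H1K (u z : H1K N) :
    (inner ℝ u z : ℝ) = inner ℝ u.toL2 z.toL2 + ∑ i, inner ℝ (u.partial i) (z.partial i) := by
  rw [Submodule.coe_inner, WithLp.prod_inner_apply]
  rfl

end WeightedSpaces

/-! ### Multiplication by bounded coefficients depending on space and time -/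

section Multiplication

variable {N : ℕ}

instance (N : ℕ) : SecondCountableTopology (L2K N) :=
  haveI : Fact ((2 : ENNReal) ≠ ⊤) := ⟨by norm_num⟩
  inferInstance

lemma memLp_bounded_mul {a : EuclideanSpace ℝ (Fin N) → ℝ} (ha : Measurable a) {c : ℝ}
    (hc : ∀ y, |a y| ≤ c) (f : L2K N) : MemLp (fun y => a y * f y) 2 (weightMeasure N) :=
  (Lp.memLp f).of_le_mul (c := c) (ha.aestronglyMeasurable.mul (Lp.aestronglyMeasurable f))
    (Filter.Eventually.of_forall fun y => by
      rw [norm_mul]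
      exact mul_le_mul_of_nonneg_right (hc y) (norm_nonneg _))

/-- Multiplication of an element of `L²(K)` by a bounded measurable function. -/
def boundedMul {a : EuclideanSpace ℝ (Fin N) → ℝ} (ha : Measurable a) {c : ℝ}
    (hc : ∀ y, |a y| ≤ c) (f : L2K N) : L2K N :=
  (memLp_bounded_mul ha hc f).toLp _

section
variable {a : EuclideanSpace ℝ (Fin N) → ℝ} (ha : Measurable a) {c : ℝ} (hc : ∀ y, |a y| ≤ c)
include ha hc

lemma coeFn_boundedMul (f : L2K N) :
    ∀ᵐ y ∂(weightMeasure N), boundedMul ha hc f y = a y * f y :=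
  MemLp.coeFn_toLp _

lemma norm_boundedMul_le (f : L2K N) : ‖boundedMul ha hc f‖ ≤ c * ‖f‖ := by
  refine Lp.norm_le_mul_norm_of_ae_le_mul ?_
  filter_upwards [coeFn_boundedMul ha hc f] with y hy
  rw [hy, norm_mul]
  exact mul_le_mul_of_nonneg_right (hc y) (norm_nonneg _)

lemma boundedMul_add (f g : L2K N) :
    boundedMul ha hc (f + g) = boundedMul ha hc f + boundedMul ha hc g := by
  refine Lp.ext ?_
  filter_upwards [coeFn_boundedMul ha hc (f + g), coeFn_boundedMul ha hc f,
    coeFn_boundedMul ha hc g, Lp.coeFn_add f g,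
    Lp.coeFn_add (boundedMul ha hc f) (boundedMul ha hc g)] with y h1 h2 h3 h4 h5
  rw [h1, h5, Pi.add_apply, h2, h3, h4, Pi.add_apply, mul_add]

lemma boundedMul_smul (r : ℝ) (f : L2K N) :
    boundedMul ha hc (r • f) = r • boundedMul ha hc f := by
  refine Lp.ext ?_
  filter_upwards [coeFn_boundedMul ha hc (r • f), coeFn_boundedMul ha hc f, Lp.coeFn_smul r f,
    Lp.coeFn_smul r (boundedMul ha hc f)] with y h1 h2 h3 h4
  rw [h1, h4, Pi.smul_apply, h2, h3, Pi.smul_apply, smul_eq_mul, smul_eq_mul]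
  ring

lemma inner_boundedMul (f g : L2K N) :
    inner ℝ (boundedMul ha hc f) g = ∫ y, a y * f y * g y ∂(weightMeasure N) := by
  rw [L2.inner_def]
  refine integral_congr_ae ?_
  filter_upwards [coeFn_boundedMul ha hc f] with y hy
  rw [hy, real_inner_comm]
  rfl

lemma inner_boundedMul_comm (f g : L2K N) :
    inner ℝ (boundedMul ha hc f) g = inner ℝ f (boundedMul ha hc g) := by
  rw [← real_inner_comm, real_inner_comm, inner_boundedMul, real_inner_comm, inner_boundedMul]
  refine integral_congr_ae (Filter.Eventually.of_forall fun y => ?_)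
  simp only
  ring

end

section
variable {a : EuclideanSpace ℝ (Fin N) × ℝ → ℝ} (ha : Measurable a) {c : ℝ}
  (hc : ∀ x, |a x| ≤ c)
include ha hc

/-- By Pettis only scalar products with a fixed f matter; these are integrals in y of a jointly
measurable function. -/
lemma stronglyMeasurable_boundedMul_const (g : L2K N) :
    StronglyMeasurable fun s : ℝ =>
      boundedMul (ha.comp (measurable_prodMk_right (y := s))) (fun y => hc (y, s)) g := by
  refine stronglyMeasurable_of_inner fun f => ?_
  refine StronglyMeasurable.measurable ?_
  have e : (fun s : ℝ => (inner ℝ f (boundedMul (ha.comp (measurable_prodMk_right (y := s)))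
      (fun y => hc (y, s)) g) : ℝ)) = fun s => ∫ y, a (y, s) * g y * f y ∂(weightMeasure N) :=
    funext fun s => by rw [real_inner_comm, inner_boundedMul]; rfl
  rw [e]
  refine StronglyMeasurable.integral_prod_left (f := fun y s => a (y, s) * g y * f y) ?_
  exact (ha.stronglyMeasurable.mul ((Lp.stronglyMeasurable g).comp_measurable measurable_fst)).mul
    ((Lp.stronglyMeasurable f).comp_measurable measurable_fst)

/-- f(s) need not have a jointly measurable representative in (y, s). Multiplication is symmetric,
so in scalar products the coefficient can be moved onto the fixed g. -/
lemma stronglyMeasurable_boundedMul {f : ℝ → L2K N} (hf : StronglyMeasurable f) :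
    StronglyMeasurable fun s : ℝ =>
      boundedMul (ha.comp (measurable_prodMk_right (y := s))) (fun y => hc (y, s)) (f s) := by
  refine stronglyMeasurable_of_inner fun g => ?_
  have e : (fun s : ℝ => (inner ℝ g (boundedMul (ha.comp (measurable_prodMk_right (y := s)))
      (fun y => hc (y, s)) (f s)) : ℝ)) = fun s => inner ℝ (f s)
        (boundedMul (ha.comp (measurable_prodMk_right (y := s))) (fun y => hc (y, s)) g) :=
    funext fun s => by rw [real_inner_comm, inner_boundedMul_comm]
  rw [e]
  exact (hf.inner (stronglyMeasurable_boundedMul_const ha hc g)).measurable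

lemma memLp_boundedMul {S : ℝ} (f : L2Time S (L2K N)) :
    MemLp (fun s : ℝ => boundedMul (ha.comp (measurable_prodMk_right (y := s)))
      (fun y => hc (y, s)) (f s)) 2 (timeMeasure S) :=
  (Lp.memLp f).of_le_mul
    (stronglyMeasurable_boundedMul ha hc (Lp.stronglyMeasurable f)).aestronglyMeasurable
    (Filter.Eventually.of_forall fun s => norm_boundedMul_le _ _ (f s))

end

/-- Multiplication of an element of `L²(0, S; L²(K))` by a bounded measurable function of `(y, s)`. -/
def timeMul (S : ℝ) {a : EuclideanSpace ℝ (Fin N) × ℝ → ℝ} (ha : Measurable a) {c : ℝ}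
    (hc : ∀ x, |a x| ≤ c) : L2Time S (L2K N) →L[ℝ] L2Time S (L2K N) :=
  LinearMap.mkContinuous
    { toFun := fun f => (memLp_boundedMul ha hc f).toLp _
      map_add' := fun f g => by
        refine Lp.ext ?_
        filter_upwards [(memLp_boundedMul ha hc (f + g)).coeFn_toLp,
          (memLp_boundedMul ha hc f).coeFn_toLp, (memLp_boundedMul ha hc g).coeFn_toLp,
          Lp.coeFn_add f g, Lp.coeFn_add ((memLp_boundedMul ha hc f).toLp _)
            ((memLp_boundedMul ha hc g).toLp _)] with s h1 h2 h3 h4 h5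
        rw [h1, h5, Pi.add_apply, h2, h3, h4, Pi.add_apply, boundedMul_add]
      map_smul' := fun r f => by
        refine Lp.ext ?_
        filter_upwards [(memLp_boundedMul ha hc (r • f)).coeFn_toLp,
          (memLp_boundedMul ha hc f).coeFn_toLp, Lp.coeFn_smul r f,
          Lp.coeFn_smul r ((memLp_boundedMul ha hc f).toLp _)] with s h1 h2 h3 h4
        rw [RingHom.id_apply, h1, h4, Pi.smul_apply, h2, h3, Pi.smul_apply, boundedMul_smul] }
    c
    (fun f => by
      refine Lp.norm_le_mul_norm_of_ae_le_mul ?_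
      filter_upwards [(memLp_boundedMul ha hc f).coeFn_toLp] with s hs
      exact (congrArg norm hs).trans_le (norm_boundedMul_le _ _ (f s)))

lemma coeFn_timeMul {S : ℝ} {a : EuclideanSpace ℝ (Fin N) × ℝ → ℝ} (ha : Measurable a) {c : ℝ}
    (hc : ∀ x, |a x| ≤ c) (f : L2Time S (L2K N)) :
    ∀ᵐ s ∂(timeMeasure S), timeMul S ha hc f s
      = boundedMul (ha.comp (measurable_prodMk_right (y := s))) (fun y => hc (y, s)) (f s) :=
  (memLp_boundedMul ha hc f).coeFn_toLp

end Multiplication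

/-! ### The lower order operator and the state form -/

section LowerOrder

variable {N : ℕ} {S : ℝ}

/-- An essentially bounded function on `ℝᴺ × (0, S)` has a bounded measurable representative. -/
lemma exists_bounded_representative {a : EuclideanSpace ℝ (Fin N) × ℝ → ℝ}
    (ha : MemLp a ⊤ (volume.restrict (univ ×ˢ Ioo 0 S))) :
    ∃ (a' : EuclideanSpace ℝ (Fin N) × ℝ → ℝ) (c : ℝ), Measurable a' ∧ (∀ x, |a' x| ≤ c) ∧
      ∀ᵐ s ∂(timeMeasure S), ∀ᵐ y ∂(weightMeasure N), a (y, s) = a' (y, s) := by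
  set c : ℝ := (eLpNorm a ⊤ (volume.restrict (univ ×ˢ Ioo 0 S))).toReal with hc
  have hc0 : 0 ≤ c := ENNReal.toReal_nonneg
  obtain ⟨a₁, ha₁, haa₁⟩ := ha.1
  -- Clamping at the essential supremum makes the bound hold everywhere, so multiplication is
  -- defined at every time.
  refine ⟨fun x => max (-c) (min (a₁ x) c), c, ?_, ?_, ?_⟩
  · exact measurable_const.max (ha₁.measurable.min measurable_const)
  · intro x
    rw [abs_le]
    exact ⟨le_max_left _ _, max_le (by linarith) (min_le_right _ _)⟩
  · have h1 : ∀ᵐ x ∂(volume.restrict ((univ : Set (EuclideanSpace ℝ (Fin N))) ×ˢ Ioo 0 S)),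
        a x = max (-c) (min (a₁ x) c) := by
      have h2 : ∀ᵐ x ∂(volume.restrict ((univ : Set (EuclideanSpace ℝ (Fin N))) ×ˢ Ioo 0 S)),
          ‖a x‖ ≤ c := by
        filter_upwards [ae_le_eLpNormEssSup (f := a)] with x hx
        rw [hc, ← toReal_enorm]
        refine ENNReal.toReal_mono ha.2.ne ?_
        rwa [eLpNorm_exponent_top]
      filter_upwards [haa₁, h2] with x h3 h4
      rw [← h3]
      rw [Real.norm_eq_abs, abs_le] at h4
      rw [min_eq_left h4.2, max_eq_right h4.1]
    have h5 : (volume.restrict ((univ : Set (EuclideanSpace ℝ (Fin N))) ×ˢ Ioo (0 : ℝ) S))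
        = volume.prod (timeMeasure S) := by
      rw [Measure.volume_eq_prod, ← Measure.prod_restrict, Measure.restrict_univ]
    rw [h5] at h1
    -- The factors are swapped so that the slices of the null set are taken at fixed s.
    have h6 := (Measure.measurePreserving_swap (μ := timeMeasure S)
      (ν := (volume : Measure (EuclideanSpace ℝ (Fin N))))).quasiMeasurePreserving.ae h1
    filter_upwards [Measure.ae_ae_of_ae_prod h6] with s hs
    exact ae_weight_of_volume hs

lemma memLp_top_component {B : EuclideanSpace ℝ (Fin N) × ℝ → EuclideanSpace ℝ (Fin N)}
    (hB : MemLp B ⊤ (volume.restrict (univ ×ˢ Ioo 0 S))) (i : Fin N) :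
    MemLp (fun x => B x i) ⊤ (volume.restrict (univ ×ˢ Ioo 0 S)) :=
  (EuclideanSpace.proj (𝕜 := ℝ) i).comp_memLp' hB

variable {V : Type} [NormedAddCommGroup V] [InnerProductSpace ℝ V]

/-- The operator `v ↦ a (j v) + ∑ᵢ bᵢ (dᵢ v) - (N/2 + 1) j v`, from `L²(0, S; V)` to
`L²(0, S; L²(K))`. -/
def lowerOrderOp (S : ℝ) (j : V →L[ℝ] L2K N) (d : Fin N → V →L[ℝ] L2K N)
    {a : EuclideanSpace ℝ (Fin N) × ℝ → ℝ} (ha : Measurable a) {cA : ℝ}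
    (hcA : ∀ x, |a x| ≤ cA) {b : Fin N → EuclideanSpace ℝ (Fin N) × ℝ → ℝ}
    (hb : ∀ i, Measurable (b i)) {cB : Fin N → ℝ} (hcB : ∀ i x, |b i x| ≤ cB i) :
    L2Time S V →L[ℝ] L2Time S (L2K N) :=
  timeMul S ha hcA ∘L timeMap S j
    + (∑ i, timeMul S (hb i) (hcB i) ∘L timeMap S (d i))
    -- The extra 1 cancels the L²(K) part of the H¹(K) inner product, which the state form does not
    -- contain.
    - ((N : ℝ) / 2 + 1) • timeMap S j

variable (j : V →L[ℝ] L2K N) (d : Fin N → V →L[ℝ] L2K N)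
  {a : EuclideanSpace ℝ (Fin N) × ℝ → ℝ} (ha : Measurable a) {cA : ℝ}
  (hcA : ∀ x, |a x| ≤ cA) {b : Fin N → EuclideanSpace ℝ (Fin N) × ℝ → ℝ}
  (hb : ∀ i, Measurable (b i)) {cB : Fin N → ℝ} (hcB : ∀ i x, |b i x| ≤ cB i)

lemma coeFn_lowerOrderOp (v : L2Time S V) :
    ∀ᵐ s ∂(timeMeasure S), lowerOrderOp S j d ha hcA hb hcB v s
      = boundedMul (ha.comp (measurable_prodMk_right (y := s))) (fun y => hcA (y, s)) (j (v s))
        + (∑ i, boundedMul ((hb i).comp (measurable_prodMk_right (y := s)))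
            (fun y => hcB i (y, s)) (d i (v s)))
        - ((N : ℝ) / 2 + 1) • j (v s) := by
  set f₀ := timeMap S j v with hf₀
  set f : Fin N → L2Time S (L2K N) := fun i => timeMul S (hb i) (hcB i)
    (timeMap S (d i) v) with hf
  have h0 : lowerOrderOp S j d ha hcA hb hcB v
      = timeMul S ha hcA f₀ + (∑ i, f i) - ((N : ℝ) / 2 + 1) • f₀ := by
    simp only [lowerOrderOp, sub_apply, add_apply, sum_apply,
      ContinuousLinearMap.comp_apply, smul_apply, hf₀, hf]
  rw [h0]
  filter_upwards [Lp.coeFn_sub (timeMul S ha hcA f₀ + ∑ i, f i) (((N : ℝ) / 2 + 1) • f₀),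
    Lp.coeFn_add (timeMul S ha hcA f₀) (∑ i, f i), Lp.coeFn_smul ((N : ℝ) / 2 + 1) f₀,
    coeFn_timeMul ha hcA f₀, coeFn_timeMap j v, Lp.coeFn_finsetSum Finset.univ f,
    ae_all_iff.2 fun i => coeFn_timeMul (hb i) (hcB i) (timeMap S (d i) v),
    ae_all_iff.2 fun i => coeFn_timeMap (d i) v] with s h1 h2 h3 h4 h5 h6 h7 h8
  rw [h1, Pi.sub_apply, h2, Pi.add_apply, h3, Pi.smul_apply, h4, hf₀, h5, h6]
  congr 2
  rw [Finset.sum_apply]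
  refine Finset.sum_congr rfl fun i _ => ?_
  rw [hf, h7, h8]

lemma norm_lowerOrderOp_le (v : L2Time S V) :
    ∀ᵐ s ∂(timeMeasure S), ‖lowerOrderOp S j d ha hcA hb hcB v s‖
      ≤ (cA * ‖j‖ + (∑ i, cB i * ‖d i‖)
        + ((N : ℝ) / 2 + 1) * ‖j‖) * ‖v s‖ := by
  have hcA0 : 0 ≤ cA := (abs_nonneg _).trans (hcA 0)
  have hcB0 : ∀ i, 0 ≤ cB i := fun i => (abs_nonneg _).trans (hcB i 0)
  filter_upwards [coeFn_lowerOrderOp j d ha hcA hb hcB v] with s hs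
  rw [hs, add_mul, add_mul, Finset.sum_mul]
  refine (norm_sub_le _ _).trans (add_le_add ((norm_add_le _ _).trans (add_le_add ?_ ?_)) ?_)
  · rw [mul_assoc]
    exact (norm_boundedMul_le _ _ _).trans
      (mul_le_mul_of_nonneg_left (ContinuousLinearMap.le_opNorm _ _) hcA0)
  · refine (norm_sum_le _ _).trans (Finset.sum_le_sum fun i _ => ?_)
    rw [mul_assoc]
    exact (norm_boundedMul_le _ _ _).trans
      (mul_le_mul_of_nonneg_left ((d i).le_opNorm (v s)) (hcB0 i))
  · rw [norm_smul, Real.norm_of_nonneg (by positivity), mul_assoc]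
    exact mul_le_mul_of_nonneg_left (ContinuousLinearMap.le_opNorm _ _) (by positivity)

/-- The form of the state equation is `(v, z)_{H¹(K)} + (C v, z)`, `C` being the lower order
operator. -/
lemma stateForm_eq {A : EuclideanSpace ℝ (Fin N) × ℝ → ℝ}
    {B : EuclideanSpace ℝ (Fin N) × ℝ → EuclideanSpace ℝ (Fin N)} {s : ℝ}
    (hA : ∀ᵐ y ∂(weightMeasure N), A (y, s) = a (y, s))
    (hB : ∀ i, ∀ᵐ y ∂(weightMeasure N), B (y, s) i = b i (y, s)) (u z : H1K N) :
    stateForm A B s u z = inner ℝ u z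
      + inner ℝ (boundedMul (ha.comp (measurable_prodMk_right (y := s))) (fun y => hcA (y, s)) u.toL2
        + (∑ i, boundedMul ((hb i).comp (measurable_prodMk_right (y := s)))
            (fun y => hcB i (y, s)) (u.partial i))
        - ((N : ℝ) / 2 + 1) • u.toL2) z.toL2 := by
  set fA := boundedMul (ha.comp (measurable_prodMk_right (y := s))) (fun y => hcA (y, s)) u.toL2
    with hfA
  set fB : Fin N → L2K N := fun i => boundedMul ((hb i).comp (measurable_prodMk_right (y := s)))
    (fun y => hcB i (y, s)) (u.partial i) with hfB
  have i1 : ∀ f g : L2K N, Integrable (fun y => f y * g y) (weightMeasure N) := fun f g =>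
    (Lp.memLp f).integrable_mul (Lp.memLp g)
  have i2 : ∀ f g : L2K N, (inner ℝ f g : ℝ) = ∫ y, f y * g y ∂(weightMeasure N) := fun f g => by
    rw [L2.inner_def]
    refine integral_congr_ae (Filter.Eventually.of_forall fun y => ?_)
    simp only
    rw [real_inner_comm]
    rfl
  have h1 : stateForm A B s u z = ∫ y, ((∑ i, u.partial i y * z.partial i y) + fA y * z.toL2 y
      + (∑ i, fB i y * z.toL2 y) - (N : ℝ) / 2 * (u.toL2 y * z.toL2 y)) ∂(weightMeasure N) := by
    refine integral_congr_ae ?_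
    filter_upwards [hA, ae_all_iff.2 hB, coeFn_boundedMul
        (ha.comp (measurable_prodMk_right (y := s))) (fun y => hcA (y, s)) u.toL2,
      ae_all_iff.2 fun i => coeFn_boundedMul ((hb i).comp (measurable_prodMk_right (y := s)))
        (fun y => hcB i (y, s)) (u.partial i)] with y e1 e2 e3 e4
    rw [hfA, e3, e1, Finset.sum_mul]
    simp only [hfB, e4, e2, Function.comp_apply]
    ring
  rw [h1, integral_sub, integral_add, integral_add, integral_finsetSum, integral_finsetSum,
    integral_const_mul, inner_H1K, inner_sub_left, inner_add_left, sum_inner, inner_smul_left]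
  · simp only [i2, conj_trivial]
    ring
  · exact fun i _ => i1 _ _
  · exact fun i _ => i1 _ _
  · exact integrable_finsetSum _ fun i _ => i1 _ _
  · exact i1 _ _
  · exact (integrable_finsetSum _ fun i _ => i1 _ _).add (i1 _ _)
  · exact integrable_finsetSum _ fun i _ => i1 _ _
  · exact ((integrable_finsetSum _ fun i _ => i1 _ _).add (i1 _ _)).add
      (integrable_finsetSum _ fun i _ => i1 _ _)
  · exact (i1 _ _).const_mul _

end LowerOrder

/-! ### Weak solutions and transposition in a Hilbert triple -/

section Transposition

variable {V H : Type} [NormedAddCommGroup V] [InnerProductSpace ℝ V] [CompleteSpace V]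
  [NormedAddCommGroup H] [InnerProductSpace ℝ H] [CompleteSpace H]

/-- The map `f ↦ (z ↦ (f, j z))` from `H` to the dual of `V`. -/
def pivotMap (j : V →L[ℝ] H) : H →L[ℝ] V →L[ℝ] ℝ :=
  LinearMap.mkContinuous
    { toFun := fun f => innerSL ℝ f ∘L j
      map_add' := fun f g => by ext z; simp
      map_smul' := fun c f => by ext z; simp }
    ‖j‖
    (fun f => by
      refine (ContinuousLinearMap.opNorm_comp_le _ _).trans ?_
      rw [innerSL_apply_norm, mul_comm])

/-- Solutions of `∂ₜ v + F v = φ`, `v(0) = 0` for a Hilbert triple `V ⊂ H ⊂ V'` with inclusion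
`j`, where `F s` is the form of the operator at time `s`; `U` is the representative of `v` in `C([0, S]; H)`. -/
structure IsTripleSolution (S : ℝ) (j : V →L[ℝ] H) (F : ℝ → V → V → ℝ)
    (φ : L2Time S H) (v : L2Time S V) (U : ℝ → H) : Prop where
  continuousOn : ContinuousOn U (Icc 0 S)
  ae_eq : ∀ᵐ s ∂(timeMeasure S), U s = j (v s)
  initial : U 0 = 0
  equation : ∃ w : L2Time S (V →L[ℝ] ℝ),
    (∀ θ : ℝ → ℝ, ContDiff ℝ ∞ θ → HasCompactSupport θ → tsupport θ ⊆ Ioo 0 S →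
      ∫ s in Ioo 0 S, deriv θ s • (innerSL ℝ (j (v s)) ∘L j) = -∫ s in Ioo 0 S, θ s • w s) ∧
    ∀ᵐ s ∂(timeMeasure S), ∀ z : V,
      w s z + F s (v s) z = inner ℝ (φ s) (j z)

lemma integrable_test_smul {E : Type} [NormedAddCommGroup E] [NormedSpace ℝ E] {S : ℝ}
    {w : ℝ → E} (hw : Integrable w (timeMeasure S)) {θ : ℝ → ℝ} (hθ : Continuous θ)
    (hc : HasCompactSupport θ) : Integrable (fun s => θ s • w s) (timeMeasure S) := by
  obtain ⟨M, hM⟩ := hθ.bounded_above_of_compact_support hc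
  exact hw.bdd_smul M hθ.aestronglyMeasurable (Filter.Eventually.of_forall hM)

variable {S : ℝ} {j : V →L[ℝ] H} {F : ℝ → V → V → ℝ}
  {C : L2Time S V →L[ℝ] L2Time S H} {φ : L2Time S H}
  {v : L2Time S V} {U : ℝ → H}

omit [CompleteSpace V] [CompleteSpace H] in
lemma integrable_pivot (j : V →L[ℝ] H) (v : L2Time S V) :
    Integrable (fun s => innerSL ℝ (j (v s)) ∘L j) (timeMeasure S) :=
  (pivotMap j ∘L j).integrable_comp (L2Time_integrable v)

lemma inner_setIntegral_L2Time {E : Type} [NormedAddCommGroup E] [InnerProductSpace ℝ E]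
    [CompleteSpace E] (f : L2Time S E) (e : E) {t : ℝ} (ht : t ≤ S) :
    ∫ s in Ioc 0 t, inner ℝ (f s) e = inner ℝ (∫ s in Ioc 0 t, f s) e := by
  simp_rw [real_inner_comm e]
  exact integral_inner (L2Time_integrableOn_Ioc f ht) e

/-- A solution satisfies the integrated equation. -/
lemma IsTripleSolution.integrated (hS : 0 < S)
    (hF : ∀ v : L2Time S V, ∀ᵐ s ∂(timeMeasure S), ∀ z,
      F s (v s) z = inner ℝ (v s) z + inner ℝ (C v s) (j z))
    (h : IsTripleSolution S j F φ v U) {t : ℝ}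
    (ht : t ∈ Icc 0 S) :
    j.adjoint (U t) + ∫ s in Ioc 0 t, v s
      = j.adjoint (∫ s in Ioc 0 t, (φ - C v : L2Time S H) s) := by
  obtain ⟨w, hw1, hw2⟩ := h.equation
  refine ext_inner_right ℝ fun z => ?_
  have hwi : Integrable w (timeMeasure S) := (Lp.memLp w).integrable (by norm_num)
  have hwz : Integrable (fun s => w s z) (timeMeasure S) :=
    (ContinuousLinearMap.apply ℝ ℝ z).integrable_comp hwi
  -- Evaluating the V'-valued derivative at a fixed z reduces the claim to the scalar du
  -- Bois-Reymond lemma.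
  have h1 : inner ℝ (U t) (j z) = ∫ s in Ioc 0 t, w s z := by
    refine eq_primitive_of_weakDeriv (u := fun t => inner ℝ (U t) (j z)) hS
      (h.continuousOn.inner continuousOn_const) hwz (by rw [h.initial, inner_zero_left])
      (fun θ k1 k2 k3 => ?_) ht
    have hc : Continuous (deriv θ) := k1.continuous_deriv (by simp)
    have e := congrArg (fun L : V →L[ℝ] ℝ => L z) (hw1 θ k1 k2 k3)
    simp only [neg_apply] at e
    rw [ContinuousLinearMap.integral_apply (integrable_test_smul (integrable_pivot j v) hc k2.deriv),
      ContinuousLinearMap.integral_apply (integrable_test_smul hwi k1.continuous k2)] at e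
    have e' : ∫ s in Ioo 0 S, deriv θ s * inner ℝ (U s) (j z)
        = ∫ s in Ioo 0 S, (deriv θ s • (innerSL ℝ (j (v s)) ∘L j)) z := by
      refine integral_congr_ae ?_
      filter_upwards [h.ae_eq] with s hs
      rw [hs]
      rfl
    rw [e', e]
    rfl
  have h2 : ∫ s in Ioc 0 t, w s z = (∫ s in Ioc 0 t, inner ℝ ((φ - C v : L2Time S H) s) (j z))
      - ∫ s in Ioc 0 t, inner ℝ (v s) z := by
    rw [← integral_sub ((L2Time_integrableOn_Ioc (φ - C v) ht.2).inner_const _)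
      ((L2Time_integrableOn_Ioc v ht.2).inner_const _)]
    refine integral_congr_ae ?_
    filter_upwards [ae_Ioc_of_ae_timeMeasure ht.2 hw2, ae_Ioc_of_ae_timeMeasure ht.2 (hF v),
      ae_Ioc_of_ae_timeMeasure ht.2 (Lp.coeFn_sub φ (C v))] with s k1 k3 k2
    rw [k2, Pi.sub_apply, inner_sub_left, ← k1 z, k3 z]
    ring
  rw [inner_add_left, ContinuousLinearMap.adjoint_inner_left,
    ContinuousLinearMap.adjoint_inner_left, h1, h2,
    inner_setIntegral_L2Time _ _ ht.2, inner_setIntegral_L2Time _ _ ht.2]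
  ring

/-- Uniqueness identifies v with the flow only a.e. in time. Both satisfy the integrated equation at
t = S itself, where injectivity of j† compares the values; this puts U(S) in the range of j. -/
lemma IsTripleSolution.final_eq (hS : 0 < S) (hj : Function.Injective j)
    (hj' : Function.Injective j.adjoint) {c : ℝ}
    (hC : ∀ v, ∀ᵐ s ∂(timeMeasure S), ‖C v s‖ ≤ c * ‖v s‖)
    (hF : ∀ v : L2Time S V, ∀ᵐ s ∂(timeMeasure S), ∀ z,
      F s (v s) z = inner ℝ (v s) z + inner ℝ (C v s) (j z))
    (h : IsTripleSolution S j F φ v U) :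
    j (perturbedFlow hS.le j C φ ⟨S, hS.le, le_rfl⟩) = U S := by
  have h1 : v = continuousToL2Time hS.le V (perturbedFlow hS.le j C φ) := by
    refine eq_perturbedFlow_of_integrated hS.le hj hj' hC φ v ?_
    filter_upwards [h.ae_eq, ae_mem_Ioo_timeMeasure S] with t h1 h2
    rw [← h1]
    exact h.integrated hS hF (Ioo_subset_Icc_self h2)
  have h2 := h.integrated hS hF (right_mem_Icc.2 hS.le)
  have h3 : perturbInverse hS.le j C φ = φ - C v := by
    rw [perturbInverse_eq_sub hS.le hj' hC, ← h1]
  have h4 := parabolicFlow_integrated hS.le hj' (φ - C v) ⟨S, hS.le, le_rfl⟩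
  have h5 : parabolicFlow hS.le j (φ - C v) = perturbedFlow hS.le j C φ := by
    rw [← h3]; rfl
  rw [h5, ← h1] at h4
  refine hj' (add_right_cancel (h4.trans h2.symm))

/-- The perturbed flow provides a solution for every right-hand side. -/
lemma isTripleSolution_perturbedFlow (hS : 0 < S) (hj' : Function.Injective j.adjoint) {c : ℝ}
    (hC : ∀ v, ∀ᵐ s ∂(timeMeasure S), ‖C v s‖ ≤ c * ‖v s‖)
    (hF : ∀ v : L2Time S V, ∀ᵐ s ∂(timeMeasure S), ∀ z,
      F s (v s) z = inner ℝ (v s) z + inner ℝ (C v s) (j z))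
    (φ : L2Time S H) :
    IsTripleSolution S j F φ (continuousToL2Time hS.le V (perturbedFlow hS.le j C φ))
      (fun s => j (IccExtend hS.le (perturbedFlow hS.le j C φ) s)) := by
  set u := perturbedFlow hS.le j C φ with hu
  set v := continuousToL2Time hS.le V u with hv
  set g : L2Time S H := φ - C v with hg
  have hflow : u = parabolicFlow hS.le j g := by
    rw [hg, hv, hu, ← perturbInverse_eq_sub hS.le hj' hC]; rfl
  have hcont : Continuous fun s => j (IccExtend hS.le u s) :=
    j.continuous.comp u.continuous.Icc_extend'
  refine ⟨hcont.continuousOn, ?_, ?_, ?_⟩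
  · filter_upwards [coeFn_continuousToL2Time hS.le u] with s hs
    rw [hs]
  · rw [IccExtend_of_mem hS.le _ (left_mem_Icc.2 hS.le), hflow, parabolicFlow_zero hS.le hj',
      map_zero]
  -- The time derivative is read off from the equation as g - Λv in V', the two terms being w₁ and
  -- w₂.
  set w₁ := (pivotMap j).compLpL 2 (timeMeasure S) g with hw₁
  set w₂ := (pivotMap (ContinuousLinearMap.id ℝ V)).compLpL 2 (timeMeasure S) v with hw₂
  have hw : ∀ᵐ s ∂(timeMeasure S), ∀ z : V,
      (w₁ - w₂ : Lp (V →L[ℝ] ℝ) 2 (timeMeasure S)) s z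
        = inner ℝ (g s) (j z) - inner ℝ (v s) z := by
    filter_upwards [Lp.coeFn_sub w₁ w₂, (pivotMap j).coeFn_compLpL (p := 2) g,
      (pivotMap (ContinuousLinearMap.id ℝ V)).coeFn_compLpL (p := 2) v] with s h1 h2 h3 z
    rw [h1, Pi.sub_apply, hw₁, hw₂, h2, h3]
    rfl
  refine ⟨w₁ - w₂, fun θ k1 k2 k3 => ?_, ?_⟩
  · have hwi : Integrable (w₁ - w₂ : Lp (V →L[ℝ] ℝ) 2 (timeMeasure S)) (timeMeasure S) :=
      (Lp.memLp _).integrable (by norm_num)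
    have hc : Continuous (deriv θ) := k1.continuous_deriv (by simp)
    ext z
    rw [neg_apply, ContinuousLinearMap.integral_apply
        (integrable_test_smul (integrable_pivot j v) hc k2.deriv),
      ContinuousLinearMap.integral_apply (integrable_test_smul hwi k1.continuous k2)]
    have hwz : Integrable (fun s => (w₁ - w₂ : Lp (V →L[ℝ] ℝ) 2 (timeMeasure S)) s z)
        (timeMeasure S) := (ContinuousLinearMap.apply ℝ ℝ z).integrable_comp hwi
    refine Eq.trans ?_ (integral_deriv_mul_primitive hS.le hwz k1 k3)
    refine integral_congr_ae ?_
    filter_upwards [coeFn_continuousToL2Time hS.le u, ae_mem_Ioo_timeMeasure S] with s e1 e2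
    have hs : s ∈ Icc 0 S := Ioo_subset_Icc_self e2
    rw [hv, e1, IccExtend_of_mem hS.le _ hs]
    change deriv θ s * inner ℝ (j (u ⟨s, hs⟩)) (j z) = _
    congr 1
    have e3 : ∫ r in Ioc 0 s, (w₁ - w₂ : Lp (V →L[ℝ] ℝ) 2 (timeMeasure S)) r z
        = (∫ r in Ioc 0 s, inner ℝ (g r) (j z)) - ∫ r in Ioc 0 s, inner ℝ (v r) z := by
      rw [← integral_sub ((L2Time_integrableOn_Ioc g hs.2).inner_const _)
        ((L2Time_integrableOn_Ioc v hs.2).inner_const _)]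
      exact integral_congr_ae ((ae_Ioc_of_ae_timeMeasure hs.2 hw).mono fun r hr => hr z)
    have e4 := congrArg (fun x => inner ℝ x z) (parabolicFlow_integrated hS.le hj' g ⟨s, hs⟩)
    simp only [inner_add_left, ContinuousLinearMap.adjoint_inner_left, timePrimitive_apply,
      ← hflow, ← hv] at e4
    refine Eq.trans ?_ e3.symm
    rw [inner_setIntegral_L2Time _ _ hs.2, inner_setIntegral_L2Time _ _ hs.2]
    linarith
  · filter_upwards [hw, Lp.coeFn_sub φ (C v), hF v] with s e1 e2 e3 z
    rw [e1 z, e3 z, hg, e2, Pi.sub_apply, inner_sub_left]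
    ring

/-- Existence, uniqueness and regularity of solutions by transposition for a Hilbert triple. -/
theorem exists_unique_transposition (hS : 0 < S) (j : V →L[ℝ] H) (hj : Function.Injective j)
    (hj' : ∀ f : H, (∀ z, inner ℝ f (j z) = 0) → f = 0) (C : L2Time S V →L[ℝ] L2Time S H) {c : ℝ}
    (hC : ∀ v, ∀ᵐ s ∂(timeMeasure S), ‖C v s‖ ≤ c * ‖v s‖)
    (hF : ∀ v : L2Time S V, ∀ᵐ s ∂(timeMeasure S), ∀ z,
      F s (v s) z = inner ℝ (v s) z + inner ℝ (C v s) (j z))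
    (ξ : V →L[ℝ] ℝ) :
    ∃ p : L2Time S H,
      (∀ φ v U, IsTripleSolution S j F φ v U →
        ∃ z : V, j z = U S ∧ ∫ s in Ioo 0 S, inner ℝ (p s) (φ s) = ξ z) ∧
      (∃ P : ℝ → V →L[ℝ] ℝ, ContinuousOn P (Icc 0 S) ∧
        (∀ᵐ s ∂(timeMeasure S), P s = innerSL ℝ (p s) ∘L j) ∧ P S = ξ) ∧
      ∀ q : L2Time S H, (∀ φ v U, IsTripleSolution S j F φ v U →
        ∃ z : V, j z = U S ∧ ∫ s in Ioo 0 S, inner ℝ (q s) (φ s) = ξ z) → q = p := by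
  have hadj : Function.Injective j.adjoint := (injective_iff_map_eq_zero _).2 fun f hf =>
    hj' f fun z => by rw [← ContinuousLinearMap.adjoint_inner_left, hf, inner_zero_left]
  set ζ : V := (InnerProductSpace.toDual ℝ V).symm ξ with hζ
  have hξ : ∀ z, ξ z = inner ℝ ζ z := fun z => by
    rw [hζ, InnerProductSpace.toDual_symm_apply]
  set p := transpositionSolution hS.le j C ζ with hp
  have hpφ : ∀ φ : L2Time S H, inner ℝ p φ = ξ (perturbedFlow hS.le j C φ ⟨S, hS.le, le_rfl⟩) :=
    fun φ => by rw [hp, inner_transpositionSolution, hξ]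
  refine ⟨p, fun φ v U h => ?_, ?_, fun q hq => ?_⟩
  · refine ⟨_, h.final_eq hS hj hadj hC hF, ?_⟩
    rw [← hpφ, L2.inner_def]
  · obtain ⟨a, ha0, ha⟩ := exists_continuous_adjoint_transpositionSolution hS.le hj hadj hC ζ
    have hext : Continuous (IccExtend hS.le a) := a.continuous.Icc_extend'
    -- For the identity of V the pivot map is the Riesz map, which carries the V-valued
    -- representative of j†p into V'.
    refine ⟨fun s => pivotMap (ContinuousLinearMap.id ℝ V) (IccExtend hS.le a (S - s)), ?_, ?_, ?_⟩
    · exact ((ContinuousLinearMap.continuous _).comp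
        (hext.comp (continuous_const.sub continuous_id))).continuousOn
    · filter_upwards [coeFn_timeMap j.adjoint p,
        coeFn_timeReverse (continuousToL2Time hS.le V a),
        (measurePreserving_reflect S).quasiMeasurePreserving.ae
          (coeFn_continuousToL2Time hS.le a)] with s h1 h2 h3
      rw [hp, ha, h2, h3] at h1
      rw [h1]
      ext z
      change inner ℝ (j.adjoint (p s)) z = inner ℝ (p s) (j z)
      rw [ContinuousLinearMap.adjoint_inner_left]
    · ext z
      change pivotMap (ContinuousLinearMap.id ℝ V) (IccExtend hS.le a (S - S)) z = ξ z
      rw [sub_self, IccExtend_of_mem hS.le _ (left_mem_Icc.2 hS.le), ha0, hξ]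
      rfl
  · refine ext_inner_right ℝ fun φ => ?_
    -- Every φ has a state, so the transposition identity fixes the pairing of q with all of L²(0,
    -- S; H).
    obtain ⟨z, hz1, hz2⟩ := hq φ _ _ (isTripleSolution_perturbedFlow hS hadj hC hF φ)
    have hz : z = perturbedFlow hS.le j C φ ⟨S, hS.le, le_rfl⟩ := by
      refine hj (hz1.trans ?_)
      rw [IccExtend_of_mem hS.le _ (right_mem_Icc.2 hS.le)]
    rw [hpφ, ← hz, ← hz2, L2.inner_def]

end Transposition

/-! ### Application to the weighted spaces -/

/-- Well-posedness by transposition for a Hilbert triple with pivot space `L²(K)` and a lower order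
perturbation with bounded coefficients. -/
theorem exists_unique_transposition_lowerOrder {N : ℕ} {S : ℝ} (hS : 0 < S) {V : Type}
    [NormedAddCommGroup V] [InnerProductSpace ℝ V] [CompleteSpace V] (j : V →L[ℝ] L2K N)
    (d : Fin N → V →L[ℝ] L2K N) (hj : Function.Injective j)
    (hj' : ∀ f : L2K N, (∀ z, inner ℝ f (j z) = 0) → f = 0)
    {a : EuclideanSpace ℝ (Fin N) × ℝ → ℝ} (ha : Measurable a) {cA : ℝ}
    (hcA : ∀ x, |a x| ≤ cA) {b : Fin N → EuclideanSpace ℝ (Fin N) × ℝ → ℝ}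
    (hb : ∀ i, Measurable (b i)) {cB : Fin N → ℝ} (hcB : ∀ i x, |b i x| ≤ cB i)
    (F : ℝ → V → V → ℝ)
    (hF : ∀ᵐ s ∂(timeMeasure S), ∀ u z, F s u z = inner ℝ u z
      + inner ℝ (boundedMul (ha.comp (measurable_prodMk_right (y := s))) (fun y => hcA (y, s)) (j u)
        + (∑ i, boundedMul ((hb i).comp (measurable_prodMk_right (y := s)))
            (fun y => hcB i (y, s)) (d i u))
        - ((N : ℝ) / 2 + 1) • j u) (j z)) (ξ : V →L[ℝ] ℝ) :
    ∃ p : L2Time S (L2K N),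
      (∀ φ v U, IsTripleSolution S j F φ v U →
        ∃ z : V, j z = U S ∧ ∫ s in Ioo 0 S, inner ℝ (p s) (φ s) = ξ z) ∧
      (∃ P : ℝ → V →L[ℝ] ℝ, ContinuousOn P (Icc 0 S) ∧
        (∀ᵐ s ∂(timeMeasure S), P s = innerSL ℝ (p s) ∘L j) ∧ P S = ξ) ∧
      ∀ q : L2Time S (L2K N), (∀ φ v U, IsTripleSolution S j F φ v U →
        ∃ z : V, j z = U S ∧ ∫ s in Ioo 0 S, inner ℝ (q s) (φ s) = ξ z) → q = p :=
  exists_unique_transposition hS j hj hj' (lowerOrderOp S j d ha hcA hb hcB)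
    (norm_lowerOrderOp_le j d ha hcA hb hcB)
    (fun v => by
      filter_upwards [coeFn_lowerOrderOp j d ha hcA hb hcB v, hF] with s h1 h2 z
      rw [h1, h2]) ξ

lemma isStateSolution_iff {N : ℕ} {S : ℝ} {A : EuclideanSpace ℝ (Fin N) × ℝ → ℝ}
    {B : EuclideanSpace ℝ (Fin N) × ℝ → EuclideanSpace ℝ (Fin N)} {φ : L2Time S (L2K N)}
    {v : L2Time S (H1K N)} {U : ℝ → L2K N} :
    IsStateSolution S A B φ 0 v U ↔ IsTripleSolution (V := H1K N) (H := L2K N) S H1K.toL2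
      (fun s => stateForm A B s) φ v U := by
  constructor
  · intro h
    obtain ⟨w, hw1, hw2⟩ := h.equation
    refine ⟨h.continuousOn, h.ae_eq, h.initial, w, ?_, ?_⟩
    · exact hw1
    · exact hw2
  · intro h
    obtain ⟨w, hw1, hw2⟩ := h.equation
    refine ⟨h.continuousOn, h.ae_eq, h.initial, w, ?_, ?_⟩
    · exact hw1
    · exact hw2

end

theorem theorem5p2 (N : ℕ) (hN : 1 ≤ N) (S : ℝ) (hS : 0 < S)
    (A : EuclideanSpace ℝ (Fin N) × ℝ → ℝ)
    (B : EuclideanSpace ℝ (Fin N) × ℝ → EuclideanSpace ℝ (Fin N))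
    (hA : MemLp A ⊤ (volume.restrict (univ ×ˢ Ioo 0 S)))
    (hB : MemLp B ⊤ (volume.restrict (univ ×ˢ Ioo 0 S)))
    (ξ : HNegK N) :
    ∃ p : L2Time S (L2K N),
      IsTranspositionSolution S A B ξ p ∧
      (∃ P : ℝ → HNegK N, ContinuousOn P (Icc 0 S) ∧
        (∀ᵐ s ∂(timeMeasure S), P s = L2K.toHNeg (p s)) ∧ P S = ξ) ∧
      ∀ q : L2Time S (L2K N), IsTranspositionSolution S A B ξ q → q = p := by
  obtain ⟨a, cA, ha, hcA, haA⟩ := exists_bounded_representative hA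
  choose b cB hb hcB hbB using fun i =>
    exists_bounded_representative (memLp_top_component hB i)
  have hform : ∀ᵐ s ∂(timeMeasure S), ∀ u z : H1K N, stateForm A B s u z = inner ℝ u z
      + inner ℝ (boundedMul (ha.comp (measurable_prodMk_right (y := s))) (fun y => hcA (y, s))
          (H1K.toL2 u)
        + (∑ i, boundedMul ((hb i).comp (measurable_prodMk_right (y := s)))
            (fun y => hcB i (y, s)) (partialCLM i u))
        - ((N : ℝ) / 2 + 1) • H1K.toL2 u) (H1K.toL2 z) := by
    filter_upwards [haA, ae_all_iff.2 hbB] with s h1 h2 u z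
    exact stateForm_eq ha hcA hb hcB h1 h2 u z
  have hdense : ∀ f : L2K N, (∀ z : H1K N, inner ℝ f (H1K.toL2 z) = 0) → f = 0 :=
    fun f hf => eq_zero_of_inner_toL2 hf
  have htriple := exists_unique_transposition_lowerOrder (V := H1K N) hS H1K.toL2 partialCLM
  have hinj := toL2_injective N
  have hcoeff := htriple hinj hdense ha hcA hb hcB (fun s => stateForm A B s)
  have hwellPosed := hcoeff hform
  have hsol := hwellPosed ξ
  obtain ⟨p, hp1, hp2, hp3⟩ := hsol
  refine ⟨p, ?_, ?_, ?_⟩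
  · intro φ v U h
    exact hp1 φ v U (isStateSolution_iff.1 h)
  · obtain ⟨P, hP1, hP2, hP3⟩ := hp2
    refine ⟨P, ?_, ?_, ?_⟩
    · exact hP1
    · exact hP2
    · exact hP3
  · intro q hq
    refine hp3 q ?_
    intro φ v U h
    exact hq φ v U (isStateSolution_iff.2 h)
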